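/- Let $D$ be a finite multi-relational database with ground variables $A[t]$ ($A$ an attribute of a relation $R$, $t$ a tuple of $R$). Let a probabilistic relational causal model over $D$ be given: exogenous variables $\varepsilon$ with a joint distribution, and for every ground variable $v$ a set $\mathrm{Pa}(v)$ of ground variables, a set $\mathrm{Pa}_\varepsilon(v)$ of exogenous variables and a structural equation $v=\phi_v(\mathrm{Pa}(v),\mathrm{Pa}_\varepsilon(v))$. The ground causal graph $G$ (edges $u\to v$ for $u\in\mathrm{Pa}(v)$) is acyclic, and the exogenous vectors $\mathrm{Pa}_\varepsilon(v)$ are mutually independent over the ground variables $v$. $\Pr_D$ is the distribution of the solution of the equations over the possible worlds (assignments of values to all ground variables). Augmented graph. Let finitely many aggregated nodes $A'=\mathrm{Agg}(A_1,\dots,A_m)$ be given, where the sources $A_1,\dots,A_m$ are ground variables that have the same children in $G$. In $G'$, $A'$ is a child of each $A_i$ and a parent of every child of the $A_i$ in $G$, and the edges of $G$ from the $A_i$ to their children are removed; all other edges of $G$ are kept. Assume that the aggregates are distribution-preserving summaries: for every ground variable $v$, the law of $\phi_v(\mathrm{pa},\cdot)$, as a function of the values $\mathrm{pa}$ of $\mathrm{Pa}(v)$,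 depends only on the values of the parents of $v$ in $G'$. Update. Let $B$ be an attribute of a relation $R$, $S$ a set of tuples of $R$ (the updated units), $\vec b$ the vector of the current values of $B$, and $f$ a map on vectors of $B$-values of the tuples of $R$ (for example, a function on $\mathrm{Dom}(B)$ applied to each unit). Write $\mathbf B=\{B[t]:t\in S\}$, and "$B=\vec b$", "$B=f(\vec b)$" for the corresponding events on the units in $S$. The update $U=(B\leftarrow f(\vec b))$ replaces the structural equation of $B[t]$, $t\in S$, by the constant $f(\vec b)_t$; $\Pr_{D,f(\vec b)}$ is the resulting distribution over possible worlds. $\Pr_{D,U}(Y\in E\mid B=\vec b,C=c)$ is the conditional probability that the post-update values of $Y$ lie in $E$, given that the pre-update values of $B$ and $C$ are $\vec b$ and $c$; here the pre-update and the post-update world are the solutions of the original and of the modified equations for the same $\varepsilon$. Backdoor criterion. Let $Y,C$ be sets of nodes of $G'$. $C$ satisfies the backdoor criterion with respect to $\mathbf B$ and $Y$ if no node of $C$ is a descendant of a node of $\mathbf B\cup Y$ (each node being a descendant of itself), and $C$ blocks every simple path from a node of $\mathbf B$ to a node of $Y$ that starts with an edge into its first node and does not meet $\mathbf B$ again. A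 path is blocked by $C$ if it has an inner non-collider in $C$, or an inner collider none of whose descendants (itself included) is in $C$. Proposition. If $C$ satisfies the backdoor criterion with respect to $\mathbf B$ and $Y$ in $G'$, then for all values $c$ of $C$ with $\Pr_D(B=f(\vec b),C=c)>0$ and all measurable sets $E$ of values of $Y$, $$\Pr\nolimits_{D,f(\vec b)}(Y\in E\mid C=c)=\Pr\nolimits_D(Y\in E\mid B=f(\vec b),C=c),$$ and, if also $\Pr_D(B=\vec b,C=c)>0$, $$\Pr\nolimits_{D,U}(Y\in E\mid B=\vec b,C=c)=\Pr\nolimits_D(Y\in E\mid B=f(\vec b),C=c).$$ -/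

import Mathlib

open MeasureTheory ProbabilityTheory

universe u

/-- A finite multi-relational database: relations, tuples (identified by their keys), attributes
(each belonging to one relation) with their domains, and the current instance. -/
structure Database where
  Rel : Type u
  Tup : Rel → Type u
  Attr : Type u
  rel : Attr → Rel
  Dom : Attr → Type u
  finTup : ∀ r, Finite (Tup r)
  finAttr : Finite Attr
  measDom : ∀ a, MeasurableSpace (Dom a)
  singDom : ∀ a, MeasurableSingletonClass (Dom a)
  /-- the value `A[t]` stored in the database -/
  inst : ∀ v : (Σ a : Attr, Tup (rel a)), Dom v.1

attribute [instance] Database.finTup Database.finAttr Database.measDom Database.singDom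

namespace Database

/-- The ground variables `A[t]`: an attribute `A` and a tuple `t` of the relation of `A`. -/
abbrev GVar (D : Database.{u}) : Type u := Σ a : D.Attr, D.Tup (D.rel a)

/-- Possible worlds: a value for every ground variable. -/
abbrev World (D : Database.{u}) : Type u := ∀ v : D.GVar, D.Dom v.1

end Database

/-- A probabilistic relational causal model over `D`: exogenous variables with a joint
distribution, and for every ground variable its endogenous parents, its exogenous parents and its
structural equation; the ground causal graph (edges `w ⟶ v` for `w ∈ pa v`) is acyclic. -/
structure PRCM (D : Database.{u}) where
  Exo : Type u
  Noise : Exo → Type u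
  measNoise : ∀ e, MeasurableSpace (Noise e)
  /-- the joint distribution of the exogenous variables -/
  prNoise : Measure (∀ e, Noise e)
  probNoise : IsProbabilityMeasure prNoise
  pa : D.GVar → Set D.GVar
  paExo : D.GVar → Set Exo
  eqn : ∀ v : D.GVar, (∀ w : pa v, D.Dom w.1.1) → (∀ e : paExo v, Noise e.1) → D.Dom v.1
  measurable_eqn : ∀ v, Measurable
    (fun q : (∀ w : pa v, D.Dom w.1.1) × (∀ e : paExo v, Noise e.1) => eqn v q.1 q.2)
  acyclic : ∀ v, ¬ Relation.TransGen (fun w w' => w ∈ pa w') v v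

attribute [instance] PRCM.measNoise PRCM.probNoise

namespace PRCM

variable {D : Database.{u}} (M : PRCM D)

theorem wf : WellFounded (fun w v : D.GVar => w ∈ M.pa v) := by
  have : Std.Irrefl (Relation.TransGen (fun w v : D.GVar => w ∈ M.pa v)) := ⟨M.acyclic⟩
  have h := Finite.wellFounded_of_trans_of_irrefl
    (Relation.TransGen (fun w v : D.GVar => w ∈ M.pa v))
  exact WellFounded.mono h fun _ _ h => Relation.TransGen.single h

/-- Markovian model: the noise vectors entering the different structural equations are mutually
independent. -/
def Markovian : Prop :=
  iIndepFun (fun (v : D.GVar) (ε : ∀ e, M.Noise e) (e : M.paExo v) => ε e.1) M.prNoise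

open Classical in
/-- The solution, for given values of the exogenous variables, of the structural equations in
which the equation of each `v ∈ T` is replaced by the constant `x v`. -/
noncomputable def solve (T : Set D.GVar) (x : D.World) (ε : ∀ e, M.Noise e) : D.World :=
  M.wf.fix (C := fun v => D.Dom v.1) fun v rec =>
    if v ∈ T then x v else M.eqn v (fun w => rec w.1 w.2) (fun e => ε e.1)

open Classical in
theorem solve_eq (T : Set D.GVar) (x : D.World) (ε : ∀ e, M.Noise e) (v : D.GVar) :
    M.solve T x ε v =
      if v ∈ T then x v else M.eqn v (fun w => M.solve T x ε w.1) (fun e => ε e.1) := by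
  unfold solve
  rw [WellFounded.fix_eq]

theorem measurable_solve (T : Set D.GVar) (x : D.World) : Measurable (M.solve T x) := by
  classical
  refine measurable_pi_lambda _ fun v => ?_
  induction v using M.wf.induction with
  | _ v ih =>
    have hs : (fun ε => M.solve T x ε v) = fun ε =>
        if v ∈ T then x v else M.eqn v (fun w => M.solve T x ε w.1) (fun e => ε e.1) :=
      funext fun ε => M.solve_eq T x ε v
    rw [hs]
    by_cases h : v ∈ T
    · simp [h]
    · simp only [h, if_false]
      exact (M.measurable_eqn v).comp
        ((measurable_pi_lambda _ fun w => ih w.1 w.2).prodMk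
          (measurable_pi_lambda _ fun e => measurable_pi_apply e.1))

/-- The distribution over possible worlds under the intervention setting each `v ∈ T` to `x v`. -/
noncomputable def prDo (T : Set D.GVar) (x : D.World) : Measure D.World :=
  M.prNoise.map (M.solve T x)

/-- The observational distribution `Pr_D` over possible worlds (no equation is replaced). -/
noncomputable def prObs : Measure D.World := M.prDo ∅ D.inst

end PRCM

/-- A hypothetical update `B ← f(b)`: the update attribute `B`, the set `S` of units (tuples of the
relation of `B`) that are updated, and a map `f` on vectors of `B`-values of all units (an update
function on `Dom(B)` applied unit by unit is the special case `fun b t => f (b t)`). -/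
structure HypUpdate (D : Database.{u}) where
  attr : D.Attr
  units : Set (D.Tup (D.rel attr))
  f : (D.Tup (D.rel attr) → D.Dom attr) → (D.Tup (D.rel attr) → D.Dom attr)

namespace HypUpdate

variable {D : Database.{u}} (U : HypUpdate D)

/-- The ground variables `B[t]`, `t ∈ S`. -/
def nodes : Set D.GVar := {v | ∃ t ∈ U.units, v = ⟨U.attr, t⟩}

/-- The vector `b` of the current values of `B`. -/
def oldVal : D.Tup (D.rel U.attr) → D.Dom U.attr := fun t => D.inst ⟨U.attr, t⟩

/-- The vector `f(b)`. -/
def newVal : D.Tup (D.rel U.attr) → D.Dom U.attr := U.f U.oldVal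

open Classical in
/-- The current instance with the column `B` replaced by `f(b)`. -/
noncomputable def newInst : D.World := fun v =>
  Function.update (fun a t => D.inst ⟨a, t⟩) U.attr U.newVal v.1 v.2

theorem newInst_apply (t : D.Tup (D.rel U.attr)) : U.newInst ⟨U.attr, t⟩ = U.newVal t := by
  simp [newInst]

end HypUpdate

/-- The interventional distribution `Pr_{D, f(b)}`: the structural equation of `B[t]`, `t ∈ S`, is
replaced by the constant `f(b)_t`. -/
noncomputable def PRCM.prUpdate {D : Database.{u}} (M : PRCM D) (U : HypUpdate D) :
    Measure D.World := M.prDo U.nodes U.newInst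

/-- The joint distribution of the pre-update world and the post-update world: both solve the model
for the same values of the exogenous variables, the first without and the second with the
intervention. -/
noncomputable def PRCM.prPrePost {D : Database.{u}} (M : PRCM D) (U : HypUpdate D) :
    Measure (D.World × D.World) :=
  M.prNoise.map fun ε => (M.solve ∅ D.inst ε, M.solve U.nodes U.newInst ε)

/-- A finite family of aggregated attributes: the node `k` is `agg k` of the ground variables in
`src k`. -/
structure Aggregation (D : Database.{u}) where
  Idx : Type u
  finIdx : Finite Idx
  src : Idx → Set D.GVar
  AggDom : Idx → Type u
  measAggDom : ∀ k, MeasurableSpace (AggDom k)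
  singAggDom : ∀ k, MeasurableSingletonClass (AggDom k)
  agg : ∀ k, (∀ v : src k, D.Dom v.1.1) → AggDom k
  measurable_agg : ∀ k, Measurable (agg k)

attribute [instance] Aggregation.finIdx Aggregation.measAggDom Aggregation.singAggDom

namespace Aggregation

variable {D : Database.{u}} (𝒜 : Aggregation D)

/-- The nodes of the augmented graph: ground variables and aggregated nodes. -/
abbrev Node : Type u := D.GVar ⊕ 𝒜.Idx

/-- The domain of a node of the augmented graph. -/
def NodeDom : 𝒜.Node → Type u
  | .inl v => D.Dom v.1
  | .inr k => 𝒜.AggDom k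

instance (n : 𝒜.Node) : MeasurableSpace (𝒜.NodeDom n) :=
  match n with
  | .inl v => D.measDom v.1
  | .inr k => 𝒜.measAggDom k

instance (n : 𝒜.Node) : MeasurableSingletonClass (𝒜.NodeDom n) :=
  match n with
  | .inl v => D.singDom v.1
  | .inr k => 𝒜.singAggDom k

/-- The value of a node of the augmented graph in a possible world. -/
def value (w : D.World) : ∀ n : 𝒜.Node, 𝒜.NodeDom n
  | .inl v => w v
  | .inr k => 𝒜.agg k fun v => w v.1

/-- The augmented causal graph: an aggregated node is a child of each of its sources and a parent
of the children of its sources; the edges from aggregated variables to their children in the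
ground causal graph are removed. -/
def augGraph (M : PRCM D) : Digraph 𝒜.Node where
  Adj
    | .inl w, .inl v => w ∈ M.pa v ∧ ∀ k, w ∉ 𝒜.src k
    | .inl w, .inr k => w ∈ 𝒜.src k
    | .inr k, .inl v => ∃ w ∈ 𝒜.src k, w ∈ M.pa v
    | .inr _, .inr _ => False

/-- Homogeneity: variables that are aggregated together have the same children in the ground
causal graph. -/
def Homogeneous (M : PRCM D) : Prop :=
  ∀ k, ∀ w ∈ 𝒜.src k, ∀ w' ∈ 𝒜.src k, ∀ v, w ∈ M.pa v → w' ∈ M.pa v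

/-- The aggregates are distribution-preserving summaries: the conditional distribution of a ground
variable given its parents in the ground causal graph depends only on the values of its parents in
the augmented graph. -/
def DistributionPreserving (M : PRCM D) : Prop :=
  ∀ (v : D.GVar) (a a' : D.World),
    (∀ n, (𝒜.augGraph M).Adj n (.inl v) → 𝒜.value a n = 𝒜.value a' n) →
    M.prNoise.map (fun ε => M.eqn v (fun w => a w.1) (fun e => ε e.1)) =
      M.prNoise.map (fun ε => M.eqn v (fun w => a' w.1) (fun e => ε e.1))

end Aggregation

section Backdoor

variable {V : Type u} (G : Digraph V)

/-- `d` is a descendant of `v` (every node is a descendant of itself). -/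
def IsDescendant (v d : V) : Prop := Relation.ReflTransGen G.Adj v d

/-- `p 0, …, p n` is a backdoor path from the set `T` to the set `Y`: a simple path in the skeleton
of `G` from a node of `T` to a node of `Y`, meeting `T` only at its start, whose first edge points
into the start. -/
structure IsBackdoorPath (T Y : Set V) (n : ℕ) (p : ℕ → V) : Prop where
  start : p 0 ∈ T
  finish : p n ∈ Y
  pos : 0 < n
  inj : Set.InjOn p (Set.Iic n)
  adj : ∀ i < n, G.Adj (p i) (p (i + 1)) ∨ G.Adj (p (i + 1)) (p i)
  proper : ∀ i, 0 < i → i ≤ n → p i ∉ T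
  into : G.Adj (p 1) (p 0)

/-- The inner node `p (i + 1)` is a collider on the path `p`. -/
def IsCollider (p : ℕ → V) (i : ℕ) : Prop :=
  G.Adj (p i) (p (i + 1)) ∧ G.Adj (p (i + 2)) (p (i + 1))

/-- The path `p 0, …, p n` is blocked by `C`: some inner non-collider is in `C`, or some inner
collider has no descendant (itself included) in `C`. -/
def IsBlocked (C : Set V) (n : ℕ) (p : ℕ → V) : Prop :=
  ∃ i, i + 1 < n ∧
    ((¬ IsCollider G p i ∧ p (i + 1) ∈ C) ∨
      (IsCollider G p i ∧ ∀ d, IsDescendant G (p (i + 1)) d → d ∉ C))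

/-- `C` satisfies the backdoor criterion with respect to the treatments `T` and the outcomes `Y`:
no node of `C` is a descendant of a node of `T` or `Y`, and `C` blocks every backdoor path from `T`
to `Y`. (The paths that revisit `T` need not be blocked, so the criterion is implied by the one that
asks this for all paths between pairs of a treatment and an outcome; both are the same for a single
treatment node.) -/
structure BackdoorCriterion (T Y C : Set V) : Prop where
  not_descendant : ∀ v ∈ T ∪ Y, ∀ d, IsDescendant G v d → d ∉ C
  blocked : ∀ n p, IsBackdoorPath G T Y n p → IsBlocked G C n p

end Backdoor

/-!
The theorem is an ignorability statement: given `C = c`, the post-update values of `Y` are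
independent of the pre-update values of `B`. Since `C` contains no descendant of `B`, the covariates
have the same values before and after the update, and on `B = f(b)` the update changes nothing; so
all three conditional probabilities are the conditional probability of `Y ∈ E` after the update
given `C = c`.

Ignorability is proved without conditional distributions, which need not exist on the arbitrary
measurable domains. Instead the event is rewritten, for one fixed world `r` with `C = c`, as an event
in a model that falls into two parts driven by disjoint sets of independent noise vectors.

* Call a node linked if a simple path unblocked by `C` that uses no edge out of `B` joins it to
  `Y \ B`. The backdoor criterion says that no node of `B` is linked
  (`BackdoorCriterion.notMem_linked`). Among the unobserved ancestors of `B ∪ Y ∪ C`, being linked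
  passes along edges not out of `B` in both directions, and between the parents of a common child
  (`linked_of_parent`, `BackdoorCriterion.linked_of_child`,
  `BackdoorCriterion.linked_of_common_child`). So the family of every mechanism of such an ancestor
  or of a covariate lies, up to `B` and `C`, entirely inside or entirely outside the linked nodes.
* The hybrid model uses the post-update equations for the mechanisms that involve linked nodes and
  the pre-update equations for the others. Its solution carries `B` and `C` of the pre-update world
  and, after resetting `B` to `f(b)`, `Y` of the post-update world
  (`BackdoorCriterion.hybrid_eq` and the lemmas after it). It is a single world that uses every noise
  vector only once; this matters because the aggregates preserve the law of each mechanism but not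
  the dependence of its output on a common noise value.
* In the split model each mechanism reads the values of the other part, and of `C`, from `r`. On
  worlds with `C = c` this leaves the values of its parents in the augmented graph unchanged and
  hence, the aggregates being distribution preserving, also its law
  (`BackdoorCriterion.map_hybridMech_eq`). Exchanging the mechanisms one at a time shows that both
  models give every event inside `C = c` the same probability (`measure_solution_congr`).
* In the split model the event is the intersection of an event of each part, and its probability
  is a product (`BackdoorCriterion.exists_factorization`).
-/

/-! ### Open paths and the backdoor criterion -/

section OpenPaths

variable {V : Type u} {G : Digraph V} {T Y C : Set V}

/-- An open path `p 0, …, p n` into `Y \ T`: a simple path of the skeleton that uses no edge out of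
a node of `T` and is not blocked by `C`. -/
structure IsOpenPath (G : Digraph V) (T Y C : Set V) (n : ℕ) (p : ℕ → V) : Prop where
  finish : p n ∈ Y
  finish_notMem : p n ∉ T
  inj : Set.InjOn p (Set.Iic n)
  edge : ∀ i < n, (G.Adj (p i) (p (i + 1)) ∧ p i ∉ T) ∨ (G.Adj (p (i + 1)) (p i) ∧ p (i + 1) ∉ T)
  collider_of_mem : ∀ i, i + 1 < n → p (i + 1) ∈ C → IsCollider G p i
  exists_descendant : ∀ i, i + 1 < n → IsCollider G p i → ∃ d ∈ C, IsDescendant G (p (i + 1)) d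

/-- The nodes outside `C` from which an open path leads to `Y \ T`. -/
def linked (G : Digraph V) (T Y C : Set V) : Set V :=
  {v | v ∉ C ∧ ∃ n p, p 0 = v ∧ IsOpenPath G T Y C n p}

/-- The path `v, p 0, p 1, …`. -/
def consPath (v : V) (p : ℕ → V) : ℕ → V
  | 0 => v
  | i + 1 => p i

theorem IsOpenPath.drop {n j : ℕ} {p : ℕ → V} (h : IsOpenPath G T Y C (n + j) p) :
    IsOpenPath G T Y C n (fun i => p (i + j)) where
  finish := h.finish
  finish_notMem := h.finish_notMem
  inj := by
    intro a ha b hb hab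
    have ha' : a + j ∈ Set.Iic (n + j) := by simpa using ha
    have hb' : b + j ∈ Set.Iic (n + j) := by simpa using hb
    exact Nat.add_right_cancel (h.inj ha' hb' hab)
  edge i hi := by
    have := h.edge (i + j) (by omega)
    rwa [Nat.add_right_comm] at this
  collider_of_mem i hi hm := by
    have e1 : i + 1 + j = i + j + 1 := by omega
    have e2 : i + 2 + j = i + j + 2 := by omega
    have := h.collider_of_mem (i + j) (by omega) (by simpa only [e1] using hm)
    simpa only [IsCollider, e1, e2] using this
  exists_descendant i hi hc := by
    have e1 : i + 1 + j = i + j + 1 := by omega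
    have e2 : i + 2 + j = i + j + 2 := by omega
    have := h.exists_descendant (i + j) (by omega) (by simpa only [IsCollider, e1, e2] using hc)
    simpa only [e1] using this

theorem IsOpenPath.cons {n : ℕ} {p : ℕ → V} {v : V} (h : IsOpenPath G T Y C n p)
    (hv : ∀ j ≤ n, p j ≠ v)
    (he : (G.Adj v (p 0) ∧ v ∉ T) ∨ (G.Adj (p 0) v ∧ p 0 ∉ T))
    (h₁ : 0 < n → p 0 ∈ C → G.Adj v (p 0) ∧ G.Adj (p 1) (p 0))
    (h₂ : 0 < n → G.Adj v (p 0) → G.Adj (p 1) (p 0) → ∃ d ∈ C, IsDescendant G (p 0) d) :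
    IsOpenPath G T Y C (n + 1) (consPath v p) where
  finish := h.finish
  finish_notMem := h.finish_notMem
  inj := by
    rintro (_ | a) ha (_ | b) hb hab
    · rfl
    · exact absurd hab.symm (hv b (by simpa using hb))
    · exact absurd hab (hv a (by simpa using ha))
    · exact congrArg _ (h.inj (by simpa using ha) (by simpa using hb) hab)
  edge := by
    rintro (_ | i) hi
    · exact he
    · exact h.edge i (by omega)
  collider_of_mem := by
    rintro (_ | i) hi hm
    · exact h₁ (by omega) hm
    · exact h.collider_of_mem i (by omega) hm
  exists_descendant := by
    rintro (_ | i) hi hc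
    · exact h₂ (by omega) hc.1 hc.2
    · exact h.exists_descendant i (by omega) hc

theorem IsOpenPath.mem_linked {n j : ℕ} {p : ℕ → V} (h : IsOpenPath G T Y C n p) (hj : j ≤ n)
    (hC : p j ∉ C) : p j ∈ linked G T Y C := by
  obtain ⟨m, rfl⟩ := Nat.exists_eq_add_of_le' hj
  exact ⟨hC, m, _, by simp, h.drop⟩

theorem mem_linked_of_mem {v : V} (hY : v ∈ Y) (hT : v ∉ T) (hC : v ∉ C) :
    v ∈ linked G T Y C :=
  ⟨hC, 0, fun _ => v, rfl, hY, hT, by intro a ha b hb _; simp at ha hb; omega,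
    by simp, by simp, by simp⟩

/-- An open path starting in `T` would be an unblocked backdoor path: an inner node in `T` would be
a collider, and a descendant in `C` is excluded by the criterion. -/
theorem BackdoorCriterion.notMem_linked (hC : BackdoorCriterion G T Y C) {v : V} (hv : v ∈ T) :
    v ∉ linked G T Y C := by
  rintro ⟨-, n, p, rfl, hp⟩
  have hn : 0 < n := by
    rcases Nat.eq_zero_or_pos n with rfl | h
    · exact absurd hv hp.finish_notMem
    · exact h
  have hinto : ∀ i < n, p i ∈ T → G.Adj (p (i + 1)) (p i) := fun i hi hT =>
    (hp.edge i hi).elim (fun h => absurd hT h.2) fun h => h.1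
  have hproper : ∀ i, 0 < i → i ≤ n → p i ∉ T := by
    rintro (_ | i) h0 hi hT
    · omega
    rcases Nat.lt_or_ge (i + 1) n with hlt | hge
    · have h1 : G.Adj (p i) (p (i + 1)) :=
        (hp.edge i (by omega)).elim (fun h => h.1) fun h => absurd hT h.2
      obtain ⟨d, hd, hdes⟩ := hp.exists_descendant i hlt ⟨h1, hinto _ hlt hT⟩
      exact hC.not_descendant _ (Or.inl hT) d hdes hd
    · obtain rfl : i + 1 = n := by omega
      exact hp.finish_notMem hT
  obtain ⟨i, hi, h | h⟩ := hC.blocked n p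
    { start := hv
      finish := hp.finish
      pos := hn
      inj := hp.inj
      adj := fun i hi => (hp.edge i hi).imp And.left And.left
      proper := hproper
      into := hinto 0 hn hv }
  · exact h.1 (hp.collider_of_mem i hi h.2)
  · obtain ⟨d, hd, hdes⟩ := hp.exists_descendant i hi h.1
    exact h.2 d hdes hd

/-- A child of a linked node is linked: on the prolonged path the linked node is not a collider. -/
theorem linked_of_parent (hasymm : ∀ u v, G.Adj u v → ¬ G.Adj v u) {u v : V} (huv : G.Adj u v)
    (hu : u ∈ linked G T Y C) (huT : u ∉ T) (hvC : v ∉ C) : v ∈ linked G T Y C := by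
  obtain ⟨huC, n, p, rfl, hp⟩ := hu
  by_cases hv : ∃ j ≤ n, p j = v
  · obtain ⟨j, hj, rfl⟩ := hv
    exact hp.mem_linked hj hvC
  · push Not at hv
    exact ⟨hvC, n + 1, consPath v p, rfl, hp.cons hv (Or.inr ⟨huv, huT⟩)
      (fun _ h => absurd h huC) fun _ h => absurd h (hasymm _ _ huv)⟩

/-- A linked node that is an ancestor of `T ∪ Y` but not of `C` has a directed open path to `Y`:
its descendants are linked, so that the directed path cannot run into `T`. -/
theorem BackdoorCriterion.exists_directed (hC : BackdoorCriterion G T Y C)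
    (hasymm : ∀ u v, G.Adj u v → ¬ G.Adj v u) {v s : V} (hs : s ∈ T ∪ Y)
    (hvs : IsDescendant G v s) :
    (∀ d, IsDescendant G v d → d ∉ C) → v ∈ linked G T Y C →
      ∃ n p, p 0 = v ∧ IsOpenPath G T Y C n p ∧ ∀ i < n, G.Adj (p i) (p (i + 1)) := by
  induction hvs using Relation.ReflTransGen.head_induction_on with
  | refl =>
    intro hnd hl
    have hT : s ∉ T := fun h => hC.notMem_linked h hl
    refine ⟨0, fun _ => s, rfl, ⟨hs.resolve_left hT, hT, ?_, by simp, by simp, by simp⟩, by simp⟩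
    intro a ha b hb _
    simp at ha hb
    omega
  | head huv hvs' ih =>
    rename_i u v
    intro hnd hl
    have hT : u ∉ T := fun h => hC.notMem_linked h hl
    have hnd' : ∀ d, IsDescendant G v d → d ∉ C := fun d hd => hnd d (.head huv hd)
    have hvC : v ∉ C := hnd' v .refl
    obtain ⟨n, p, rfl, hp, hdir⟩ := ih hnd' (linked_of_parent hasymm huv hl hT hvC)
    by_cases hu : ∃ j ≤ n, p j = u
    · obtain ⟨j, hj, rfl⟩ := hu
      obtain ⟨m, rfl⟩ := Nat.exists_eq_add_of_le' hj
      refine ⟨m, fun i => p (i + j), by simp, hp.drop, fun i hi => ?_⟩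
      have := hdir (i + j) (by omega)
      rwa [Nat.add_right_comm] at this
    · push Not at hu
      refine ⟨n + 1, consPath u p, rfl, hp.cons hu (Or.inl ⟨huv, hT⟩) (fun _ h => absurd h hvC)
        (fun h0 _ h => absurd h (hasymm _ _ (hdir 0 h0))), ?_⟩
      rintro (_ | i) hi
      · exact huv
      · exact hdir i (by omega)

/-- A parent of a linked node is linked: if prolonging the path turns the linked node into a
collider without descendant in `C`, a directed path replaces it. -/
theorem BackdoorCriterion.linked_of_child (hC : BackdoorCriterion G T Y C)
    (hasymm : ∀ u v, G.Adj u v → ¬ G.Adj v u) {u v : V} (huv : G.Adj u v)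
    (hv : v ∈ linked G T Y C) (hvA : ∃ s ∈ T ∪ Y ∪ C, IsDescendant G v s)
    (huT : u ∉ T) (huC : u ∉ C) : u ∈ linked G T Y C := by
  obtain ⟨n, p, hp0, hp, hopen⟩ : ∃ n p, p 0 = v ∧ IsOpenPath G T Y C n p ∧
      (0 < n → G.Adj (p 1) (p 0) → ∃ d ∈ C, IsDescendant G (p 0) d) := by
    by_cases hd : ∃ d ∈ C, IsDescendant G v d
    · obtain ⟨-, n, p, rfl, hp⟩ := hv
      exact ⟨n, p, rfl, hp, fun _ _ => hd⟩
    · obtain ⟨s, hs, hvs⟩ := hvA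
      obtain ⟨n, p, rfl, hp, hdir⟩ := hC.exists_directed hasymm
        (hs.resolve_right fun h => hd ⟨s, h, hvs⟩) hvs (fun d h h' => hd ⟨d, h', h⟩) hv
      exact ⟨n, p, rfl, hp, fun h0 h => absurd h (hasymm _ _ (hdir 0 h0))⟩
  subst hp0
  by_cases hu : ∃ j ≤ n, p j = u
  · obtain ⟨j, hj, rfl⟩ := hu
    exact hp.mem_linked hj huC
  · push Not at hu
    exact ⟨huC, n + 1, consPath u p, rfl, hp.cons hu (Or.inl ⟨huv, huT⟩)
      (fun _ h => absurd h hv.1) fun h0 _ => hopen h0⟩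

/-- Parents of a common child are linked together: an observed child is an open collider. -/
theorem BackdoorCriterion.linked_of_common_child (hC : BackdoorCriterion G T Y C)
    (hasymm : ∀ u v, G.Adj u v → ¬ G.Adj v u) {u w d : V} (hud : G.Adj u d) (hwd : G.Adj w d)
    (hdA : ∃ s ∈ T ∪ Y ∪ C, IsDescendant G d s) (hu : u ∈ linked G T Y C)
    (hwT : w ∉ T) (hwC : w ∉ C) : w ∈ linked G T Y C := by
  have huT : u ∉ T := fun h => hC.notMem_linked h hu
  by_cases hdC : d ∈ C
  swap
  · exact hC.linked_of_child hasymm hwd (linked_of_parent hasymm hud hu huT hdC) hdA hwT hwC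
  obtain ⟨huC, n, p, rfl, hp⟩ := hu
  by_cases hw : ∃ j ≤ n, p j = w
  · obtain ⟨j, hj, rfl⟩ := hw
    exact hp.mem_linked hj hwC
  push Not at hw
  by_cases hd : ∃ j ≤ n, p j = d
  · obtain ⟨j, hj, rfl⟩ := hd
    have hj0 : j ≠ 0 := by rintro rfl; exact huC hdC
    have hjn : j ≠ n := by
      rintro rfl
      exact hC.not_descendant _ (Or.inr hp.finish) _ .refl hdC
    obtain ⟨i, rfl⟩ := Nat.exists_eq_succ_of_ne_zero hj0
    have hcol := hp.collider_of_mem i (by omega) hdC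
    obtain ⟨m, rfl⟩ := Nat.exists_eq_add_of_le' hj
    have hdrop := hp.drop
    have hcons := hdrop.cons (v := w) (fun k hk => hw _ (by omega))
      (Or.inl ⟨by simpa using hwd, hwT⟩)
      (fun _ _ => ⟨by simpa using hwd, by simpa [Nat.add_comm, Nat.add_left_comm] using hcol.2⟩)
      (fun _ _ _ => ⟨p (i + 1), hdC, by rw [Nat.zero_add]; exact .refl⟩)
    exact ⟨hwC, _, _, rfl, hcons⟩
  · push Not at hd
    have h1 := hp.cons hd (Or.inr ⟨hud, huT⟩) (fun _ h => absurd h huC)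
      fun _ h => absurd h (hasymm _ _ hud)
    refine ⟨hwC, n + 2, consPath w (consPath d p), rfl, h1.cons ?_ (Or.inl ⟨hwd, hwT⟩)
      (fun _ _ => ⟨hwd, hud⟩) fun _ _ _ => ⟨d, hdC, .refl⟩⟩
    rintro (_ | j) hj
    · rintro rfl
      exact hwC hdC
    · exact hw j (by omega)

end OpenPaths

/-! ### Structural equations with independent noise -/

section FunctionalModels

variable {V : Type*} {X N : V → Type*} {r : V → V → Prop}

/-- The assignment `a` solves the equations `a v = g v a (q v)` for the noise values `q`. -/
def IsSolution (g : ∀ v, (∀ w, X w) → N v → X v) (q : ∀ v, N v) (a : ∀ v, X v) : Prop :=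
  ∀ v, a v = g v a (q v)

/-- The mechanism of `v` depends only on the values of the `r`-predecessors of `v`. -/
def IsLocal (r : V → V → Prop) (g : ∀ v, (∀ w, X w) → N v → X v) : Prop :=
  ∀ v a a', (∀ w, r w v → a w = a' w) → g v a = g v a'

theorem IsSolution.unique (hr : WellFounded r) {g : ∀ v, (∀ w, X w) → N v → X v}
    (hg : IsLocal r g) {q : ∀ v, N v} {a a' : ∀ v, X v} (h : IsSolution g q a)
    (h' : IsSolution g q a') : a = a' := by
  funext v
  induction v using hr.induction with
  | _ v ih => rw [h v, h' v, hg v a a' ih]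

open Classical in
/-- The solution of local equations by well-founded recursion; the world `x₀` fills the arguments
of a mechanism that it does not depend on. -/
noncomputable def solution (hr : WellFounded r) (x₀ : ∀ v, X v)
    (g : ∀ v, (∀ w, X w) → N v → X v) (q : ∀ v, N v) : ∀ v, X v :=
  hr.fix (C := X) fun v rec => g v (fun w => if h : r w v then rec w h else x₀ w) (q v)

theorem isSolution_solution (hr : WellFounded r) (x₀ : ∀ v, X v)
    {g : ∀ v, (∀ w, X w) → N v → X v} (hg : IsLocal r g) (q : ∀ v, N v) :
    IsSolution g q (solution hr x₀ g q) := by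
  classical
  intro v
  conv_lhs => rw [solution, WellFounded.fix_eq]
  refine congrFun (hg v _ _ fun w hw => ?_) _
  rw [dif_pos hw, solution]

variable [∀ v, MeasurableSpace (X v)] [∀ v, MeasurableSpace (N v)]

theorem measurable_solution (hr : WellFounded r) (x₀ : ∀ v, X v)
    {g : ∀ v, (∀ w, X w) → N v → X v}
    (hm : ∀ v, Measurable fun z : (∀ w, X w) × N v => g v z.1 z.2) :
    Measurable (solution hr x₀ g) := by
  classical
  refine measurable_pi_lambda _ fun v => ?_
  induction v using hr.induction with
  | _ v ih =>
    have hs : (fun q => solution hr x₀ g q v) = fun q =>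
        g v (fun w => if r w v then solution hr x₀ g q w else x₀ w) (q v) := by
      funext q
      rw [solution, WellFounded.fix_eq]
      rfl
    have hw : ∀ w, Measurable fun q => if r w v then solution hr x₀ g q w else x₀ w := by
      intro w
      by_cases hw : r w v
      · simpa only [hw, if_true] using ih w hw
      · simp only [hw, if_false, measurable_const]
    rw [hs]
    exact (hm v).comp ((measurable_pi_lambda _ hw).prodMk (measurable_pi_apply v))

/-- Replacing the mechanism of one node `u` by one with the same law at all worlds in `F` does not
change the probability of `F`. Given the noise of the other nodes, the solution is a function of
its value at `u`, and the arguments of the mechanism of `u` are fixed. -/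
theorem measure_solution_swap_one [Fintype V] (hr : WellFounded r) (x₀ : ∀ v, X v)
    (hirr : ∀ v, ¬ Relation.TransGen r v v)
    {g h : ∀ v, (∀ w, X w) → N v → X v} (hg : IsLocal r g) (hh : IsLocal r h)
    (hgm : ∀ v, Measurable fun z : (∀ w, X w) × N v => g v z.1 z.2)
    (hhm : ∀ v, Measurable fun z : (∀ w, X w) × N v => h v z.1 z.2)
    (μ : ∀ v, Measure (N v)) [∀ v, IsProbabilityMeasure (μ v)] {F : Set (∀ v, X v)}
    (hF : MeasurableSet F) (u : V) (hgh : ∀ v, v ≠ u → g v = h v)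
    (hlaw : ∀ a ∈ F, (μ u).map (g u a) = (μ u).map (h u a)) :
    Measure.pi μ (solution hr x₀ g ⁻¹' F) = Measure.pi μ (solution hr x₀ h ⁻¹' F) := by
  classical
  have hsg := measurable_solution hr x₀ hgm
  have hsh := measurable_solution hr x₀ hhm
  rw [← lintegral_indicator_one (hsg hF), ← lintegral_indicator_one (hsh hF)]
  refine lintegral_eq_of_lmarginal_eq {u} (measurable_one.indicator (hsg hF))
    (measurable_one.indicator (hsh hF)) ?_
  rw [lmarginal_singleton, lmarginal_singleton]
  funext q
  -- the model in which the value of `u` is set to `y`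
  let k : X u → ∀ v, (∀ w, X w) → N v → X v := fun y =>
    Function.update g u fun _ _ => y
  have hk : ∀ y, IsLocal r (k y) := by
    intro y v a a' haa
    by_cases hv : v = u
    · subst hv; simp [k]
    · simpa [k, hv] using hg v a a' haa
  have hkm : ∀ v, Measurable fun z : X u × (∀ w, X w) × N v => k z.1 v z.2.1 z.2.2 := by
    intro v
    by_cases hv : v = u
    · subst hv; simpa [k] using measurable_fst
    · simpa [k, hv, Function.comp_def] using (hgm v).comp measurable_snd
  let S : X u → ∀ v, X v := fun y => solution hr x₀ (k y) q
  have hS : ∀ y, IsSolution (k y) q (S y) := fun y => isSolution_solution hr x₀ (hk y) q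
  have hSu : ∀ y, S y u = y := fun y => by rw [hS y u]; simp [k]
  have hSv : ∀ y v, v ≠ u → S y v = g v (S y) (q v) := fun y v hv => by
    conv_lhs => rw [hS y v]
    simp [k, hv]
  have hSm : Measurable S := by
    refine measurable_pi_lambda _ fun v => ?_
    induction v using hr.induction with
    | _ v ih =>
      have hs : (fun y => S y v) = fun y =>
          k y v (fun w => if r w v then S y w else x₀ w) (q v) := by
        funext y
        rw [hS y v]
        refine congrFun (hk y v _ _ fun w hw => ?_) _
        rw [if_pos hw]
      have hw : ∀ w, Measurable fun y => if r w v then S y w else x₀ w := by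
        intro w
        by_cases hw : r w v
        · simpa only [hw, if_true] using ih w hw
        · simp only [hw, if_false, measurable_const]
      rw [hs]
      exact (hkm v).comp (measurable_id.prodMk
        ((measurable_pi_lambda _ hw).prodMk measurable_const))
  have hpre : ∀ y y' v, Relation.TransGen r v u → S y v = S y' v := by
    intro y y' v
    induction v using hr.induction with
    | _ v ih =>
      intro hv
      have hvu : v ≠ u := by rintro rfl; exact hirr _ hv
      rw [hSv y v hvu, hSv y' v hvu]
      exact congrFun (hg v _ _ fun w hw => ih w hw (.head hw hv)) _
  have hgS : ∀ y y', g u (S y) = g u (S y') := fun y y' =>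
    hg u _ _ fun w hw => hpre y y' w (.single hw)
  have hhS : ∀ y y', h u (S y) = h u (S y') := fun y y' =>
    hh u _ _ fun w hw => hpre y y' w (.single hw)
  have hsolg : ∀ η, solution hr x₀ g (Function.update q u η) = S (g u (S (x₀ u)) η) := by
    intro η
    refine IsSolution.unique hr hg (isSolution_solution hr x₀ hg _) fun v => ?_
    by_cases hv : v = u
    · subst hv
      rw [hSu, Function.update_self]
      exact congrFun (hgS _ _) _
    · rw [Function.update_of_ne hv, ← hSv _ v hv]
  have hsolh : ∀ η, solution hr x₀ h (Function.update q u η) = S (h u (S (x₀ u)) η) := by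
    intro η
    refine IsSolution.unique hr hh (isSolution_solution hr x₀ hh _) fun v => ?_
    by_cases hv : v = u
    · subst hv
      rw [hSu, Function.update_self]
      exact congrFun (hhS _ _) _
    · rw [Function.update_of_ne hv, ← hgh v hv, ← hSv _ v hv]
  have key : ∀ m : ∀ v, (∀ w, X w) → N v → X v,
      (∀ v, Measurable fun z : (∀ w, X w) × N v => m v z.1 z.2) →
      (∀ η, solution hr x₀ m (Function.update q u η) = S (m u (S (x₀ u)) η)) →
      ∫⁻ η, (solution hr x₀ m ⁻¹' F).indicator 1 (Function.update q u η) ∂μ u =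
        ((μ u).map (m u (S (x₀ u)))) (S ⁻¹' F) := by
    intro m hm hsol
    have hmu : Measurable (m u (S (x₀ u))) := (hm u).comp (measurable_const.prodMk measurable_id)
    rw [Measure.map_apply hmu (hSm hF), ← lintegral_indicator_one (hmu (hSm hF))]
    refine lintegral_congr fun η => ?_
    simp only [Set.indicator, Set.mem_preimage, hsol, Pi.one_apply]
  rw [key g hgm hsolg, key h hhm hsolh]
  by_cases hne : ∃ y, S y ∈ F
  · obtain ⟨y, hy⟩ := hne
    rw [hgS (x₀ u) y, hhS (x₀ u) y, hlaw _ hy]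
  · have : S ⁻¹' F = ∅ := by
      ext y
      simpa using fun hy => hne ⟨y, hy⟩
    simp [this]

/-- Two models whose mechanisms have the same laws at all worlds in `F` give the same probability
to `F`. -/
theorem measure_solution_congr [Fintype V] (hr : WellFounded r) (x₀ : ∀ v, X v)
    (hirr : ∀ v, ¬ Relation.TransGen r v v)
    {g h : ∀ v, (∀ w, X w) → N v → X v} (hg : IsLocal r g) (hh : IsLocal r h)
    (hgm : ∀ v, Measurable fun z : (∀ w, X w) × N v => g v z.1 z.2)
    (hhm : ∀ v, Measurable fun z : (∀ w, X w) × N v => h v z.1 z.2)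
    (μ : ∀ v, Measure (N v)) [∀ v, IsProbabilityMeasure (μ v)] {F : Set (∀ v, X v)}
    (hF : MeasurableSet F)
    (hlaw : ∀ v, ∀ a ∈ F, (μ v).map (g v a) = (μ v).map (h v a)) :
    Measure.pi μ (solution hr x₀ g ⁻¹' F) = Measure.pi μ (solution hr x₀ h ⁻¹' F) := by
  classical
  let m : Finset V → ∀ v, (∀ w, X w) → N v → X v := fun J v => if v ∈ J then h v else g v
  have hm : ∀ J, IsLocal r (m J) := by
    intro J v a a' haa
    by_cases hv : v ∈ J
    · simpa [m, hv] using hh v a a' haa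
    · simpa [m, hv] using hg v a a' haa
  have hmm : ∀ J v, Measurable fun z : (∀ w, X w) × N v => m J v z.1 z.2 := by
    intro J v
    by_cases hv : v ∈ J
    · simpa [m, hv] using hhm v
    · simpa [m, hv] using hgm v
  have key : ∀ J : Finset V, Measure.pi μ (solution hr x₀ g ⁻¹' F) =
      Measure.pi μ (solution hr x₀ (m J) ⁻¹' F) := by
    intro J
    induction J using Finset.induction_on with
    | empty => simp [m]
    | insert u J hu ih =>
      rw [ih]
      refine measure_solution_swap_one hr x₀ hirr (hm _) (hm _) (hmm _) (hmm _) μ hF u ?_ ?_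
      · intro v hv
        simp [m, hv]
      · intro a ha
        simpa [m, hu] using hlaw u a ha
  simpa [m] using key Finset.univ

/-- Under a product measure, events that depend on disjoint sets of coordinates are independent. -/
theorem measure_pi_inter_of_dependsOn [Fintype V] (μ : ∀ v, Measure (N v))
    [∀ v, IsProbabilityMeasure (μ v)] (s : Set V) {A B : Set (∀ v, N v)}
    (hA : MeasurableSet A) (hB : MeasurableSet B)
    (hAs : ∀ q q', (∀ v ∈ s, q v = q' v) → q ∈ A → q' ∈ A)
    (hBs : ∀ q q', (∀ v, v ∉ s → q v = q' v) → q ∈ B → q' ∈ B) :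
    Measure.pi μ (A ∩ B) = Measure.pi μ A * Measure.pi μ B := by
  classical
  obtain ⟨q₀⟩ : Nonempty (∀ v, N v) := by
    have : (Measure.pi μ) Set.univ ≠ 0 := by simp
    exact (nonempty_of_measure_ne_zero this).to_type
  let S : Finset V := Finset.univ.filter (· ∈ s)
  have hind : iIndepFun (fun v (q : ∀ v, N v) => q v) (Measure.pi μ) :=
    iIndepFun_pi (X := fun _ => id) fun _ => aemeasurable_id
  have hI := hind.indepFun_finset S Sᶜ disjoint_compl_right fun v => measurable_pi_apply v
  let eS : (∀ v : S, N v) → ∀ v, N v := fun z v => if h : v ∈ S then z ⟨v, h⟩ else q₀ v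
  let eT : (∀ v : (Sᶜ : Finset V), N v) → ∀ v, N v := fun z v =>
    if h : v ∈ Sᶜ then z ⟨v, h⟩ else q₀ v
  have heS : Measurable eS := by
    refine measurable_pi_lambda _ fun v => ?_
    by_cases h : v ∈ S
    · simpa [eS, h] using measurable_pi_apply (⟨v, h⟩ : S)
    · simp [eS, h]
  have heT : Measurable eT := by
    refine measurable_pi_lambda _ fun v => ?_
    by_cases h : v ∈ Sᶜ
    · simpa only [eT, h, dite_true] using
        measurable_pi_apply (X := fun v : (Sᶜ : Finset V) => N v) (⟨v, h⟩ : (Sᶜ : Finset V))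
    · simp only [eT, h, dite_false, measurable_const]
  have h := hI.measure_inter_preimage_eq_mul _ _ (heS hA) (heT hB)
  have hA' : (fun (q : ∀ v, N v) (v : S) => q v) ⁻¹' (eS ⁻¹' A) = A := by
    ext q
    refine ⟨hAs _ _ fun v hv => ?_, hAs _ _ fun v hv => ?_⟩ <;> simp [eS, S, hv]
  have hB' : (fun (q : ∀ v, N v) (v : (Sᶜ : Finset V)) => q v) ⁻¹' (eT ⁻¹' B) = B := by
    ext q
    refine ⟨hBs _ _ fun v hv => ?_, hBs _ _ fun v hv => ?_⟩ <;> simp [eT, S, hv]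
  rwa [hA', hB'] at h

end FunctionalModels

/-! ### The augmented graph and the two sides of the adjustment -/

section AugmentedGraph

variable {D : Database.{u}} {M : PRCM D} {𝒜 : Aggregation D}

theorem Aggregation.Homogeneous.augGraph_asymm (hhom : 𝒜.Homogeneous M) (m n : 𝒜.Node)
    (h : (𝒜.augGraph M).Adj m n) : ¬ (𝒜.augGraph M).Adj n m := by
  intro h'
  rcases m with v | k <;> rcases n with w | l
  · exact M.acyclic v (.tail (.single h.1) h'.1)
  · obtain ⟨w, hw, hwv⟩ := h'
    exact M.acyclic v (.single (hhom l w hw v h v hwv))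
  · obtain ⟨v, hv, hvw⟩ := h
    exact M.acyclic w (.single (hhom k v hv w h' w hvw))
  · exact h

/-- An edge of the ground causal graph is kept in the augmented graph or passes through an
aggregated node. -/
theorem PRCM.adj_or_exists_agg (𝒜 : Aggregation D) {v w : D.GVar} (h : w ∈ M.pa v) :
    (𝒜.augGraph M).Adj (.inl w) (.inl v) ∨
      ∃ k, w ∈ 𝒜.src k ∧ (𝒜.augGraph M).Adj (.inr k) (.inl v) := by
  by_cases hk : ∃ k, w ∈ 𝒜.src k
  · obtain ⟨k, hk⟩ := hk
    exact Or.inr ⟨k, hk, w, hk, h⟩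
  · push Not at hk
    exact Or.inl ⟨h, hk⟩

theorem isDescendant_of_mem_src {k : 𝒜.Idx} {w : D.GVar} (h : w ∈ 𝒜.src k) :
    IsDescendant (𝒜.augGraph M) (.inl w) (.inr k) :=
  .single h

theorem isDescendant_of_mem_pa (𝒜 : Aggregation D) {v w : D.GVar} (h : w ∈ M.pa v) :
    IsDescendant (𝒜.augGraph M) (.inl w) (.inl v) := by
  obtain h | ⟨k, hk, h⟩ := M.adj_or_exists_agg 𝒜 h
  · exact .single h
  · exact .tail (isDescendant_of_mem_src hk) h

theorem Aggregation.value_inr_congr {a a' : D.World} {k : 𝒜.Idx}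
    (h : ∀ w ∈ 𝒜.src k, a w = a' w) : 𝒜.value a (.inr k) = 𝒜.value a' (.inr k) :=
  congrArg (𝒜.agg k) (funext fun w => h w.1 w.2)

theorem Aggregation.measurable_value (n : 𝒜.Node) :
    Measurable fun a : D.World => 𝒜.value a n := by
  rcases n with v | k
  · exact measurable_pi_apply v
  · exact (𝒜.measurable_agg k).comp (measurable_pi_lambda _ fun w => measurable_pi_apply w.1)

theorem Aggregation.measurableSet_value_eq (C : Set 𝒜.Node) (c : ∀ n : C, 𝒜.NodeDom n.1) :
    MeasurableSet {a : D.World | ∀ n : C, 𝒜.value a n.1 = c n} := by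
  rw [Set.ofPred_forall]
  exact MeasurableSet.iInter fun n => 𝒜.measurable_value n.1 (measurableSet_singleton (c n))

/-- Nodes that are not descendants of the intervened nodes keep their values. -/
theorem PRCM.solve_eq_of_not_isDescendant (M : PRCM D) (𝒜 : Aggregation D) (T : Set D.GVar)
    (x : D.World) (ε : ∀ e, M.Noise e) (v : D.GVar)
    (hv : ∀ b ∈ T, ¬ IsDescendant (𝒜.augGraph M) (.inl b) (.inl v)) :
    M.solve ∅ D.inst ε v = M.solve T x ε v := by
  induction v using M.wf.induction with
  | _ v ih =>
    have hvT : v ∉ T := fun h => hv v h .refl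
    rw [M.solve_eq, M.solve_eq T, if_neg (Set.notMem_empty v), if_neg hvT]
    congr 1
    funext w
    exact ih w.1 w.2 fun b hb h => hv b hb (h.trans (isDescendant_of_mem_pa 𝒜 w.2))

end AugmentedGraph

section Sides

variable {D : Database.{u}} (M : PRCM D) (𝒜 : Aggregation D) (T : Set D.GVar)
  (Y C : Set 𝒜.Node)

/-- The nodes of the augmented graph with an open path to the outcomes outside the treatments. -/
def outcomeNodes : Set 𝒜.Node := linked (𝒜.augGraph M) (Sum.inl '' T) Y C

/-- The ground variables whose mechanism involves a node linked to the outcomes, be it the variable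
itself or one of its parents in the augmented graph. -/
def outcomeSide : Set D.GVar :=
  {v | ∃ n ∈ outcomeNodes M 𝒜 T Y C, n = .inl v ∨ (𝒜.augGraph M).Adj n (.inl v)}

/-- The nodes with a descendant among treatments, outcomes and covariates. -/
def relevantNodes : Set 𝒜.Node :=
  {n | ∃ s ∈ Sum.inl '' T ∪ Y ∪ C, IsDescendant (𝒜.augGraph M) n s}

variable {M 𝒜 T Y C}

theorem relevantNodes_of_isDescendant {m n : 𝒜.Node} (h : IsDescendant (𝒜.augGraph M) m n)
    (hn : n ∈ relevantNodes M 𝒜 T Y C) : m ∈ relevantNodes M 𝒜 T Y C := by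
  obtain ⟨s, hs, hns⟩ := hn
  exact ⟨s, hs, h.trans hns⟩

theorem mem_relevantNodes {n : 𝒜.Node} (h : n ∈ Sum.inl '' T ∪ Y ∪ C) :
    n ∈ relevantNodes M 𝒜 T Y C :=
  ⟨n, h, .refl⟩

theorem BackdoorCriterion.inl_notMem_outcomeNodes
    (hC : BackdoorCriterion (𝒜.augGraph M) (Sum.inl '' T) Y C) {v : D.GVar} (hv : v ∈ T) :
    .inl v ∉ outcomeNodes M 𝒜 T Y C :=
  hC.notMem_linked (Set.mem_image_of_mem _ hv)

theorem BackdoorCriterion.not_isDescendant_inl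
    (hC : BackdoorCriterion (𝒜.augGraph M) (Sum.inl '' T) Y C) {v : D.GVar} (hv : v ∈ T)
    {n : 𝒜.Node} (hn : n ∈ C) : ¬ IsDescendant (𝒜.augGraph M) (.inl v) n :=
  fun h => hC.not_descendant _ (Or.inl (Set.mem_image_of_mem _ hv)) n h hn

theorem BackdoorCriterion.notMem_of_mem_src
    (hC : BackdoorCriterion (𝒜.augGraph M) (Sum.inl '' T) Y C) {k : 𝒜.Idx} (hk : .inr k ∈ C)
    {w : D.GVar} (hw : w ∈ 𝒜.src k) : w ∉ T :=
  fun hT => hC.not_isDescendant_inl hT hk (isDescendant_of_mem_src hw)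

theorem BackdoorCriterion.mem_outcomeNodes_of_mem
    (hC : BackdoorCriterion (𝒜.augGraph M) (Sum.inl '' T) Y C) {n : 𝒜.Node} (hn : n ∈ Y)
    (hT : n ∉ Sum.inl '' T) : n ∈ outcomeNodes M 𝒜 T Y C :=
  mem_linked_of_mem hn hT (hC.not_descendant n (Or.inr hn) n .refl)

theorem mem_outcomeSide {v : D.GVar} (h : .inl v ∈ outcomeNodes M 𝒜 T Y C) :
    v ∈ outcomeSide M 𝒜 T Y C :=
  ⟨_, h, Or.inl rfl⟩

theorem BackdoorCriterion.mem_outcomeNodes_of_mem_outcomeSide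
    (hC : BackdoorCriterion (𝒜.augGraph M) (Sum.inl '' T) Y C) (hhom : 𝒜.Homogeneous M)
    {v : D.GVar} (hv : v ∈ outcomeSide M 𝒜 T Y C) (hvC : .inl v ∉ C) :
    .inl v ∈ outcomeNodes M 𝒜 T Y C := by
  obtain ⟨n, hn, rfl | hnv⟩ := hv
  · exact hn
  · exact linked_of_parent hhom.augGraph_asymm hnv hn (fun h => hC.notMem_linked h hn) hvC

theorem BackdoorCriterion.notMem_outcomeSide
    (hC : BackdoorCriterion (𝒜.augGraph M) (Sum.inl '' T) Y C) (hhom : 𝒜.Homogeneous M)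
    {v : D.GVar} (hv : v ∈ T) : v ∉ outcomeSide M 𝒜 T Y C := fun h =>
  hC.inl_notMem_outcomeNodes hv (hC.mem_outcomeNodes_of_mem_outcomeSide hhom h fun hvC =>
    hC.not_isDescendant_inl hv hvC .refl)

/-- All unobserved, untreated parents of a mechanism on the outcome side are linked to the
outcomes. -/
theorem BackdoorCriterion.parent_mem_outcomeNodes
    (hC : BackdoorCriterion (𝒜.augGraph M) (Sum.inl '' T) Y C) (hhom : 𝒜.Homogeneous M)
    {v : D.GVar} (hv : v ∈ outcomeSide M 𝒜 T Y C) (hvA : .inl v ∈ relevantNodes M 𝒜 T Y C)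
    {n : 𝒜.Node} (hnv : (𝒜.augGraph M).Adj n (.inl v)) (hnT : n ∉ Sum.inl '' T) (hnC : n ∉ C) :
    n ∈ outcomeNodes M 𝒜 T Y C := by
  obtain ⟨m, hm, rfl | hmv⟩ := hv
  · exact hC.linked_of_child hhom.augGraph_asymm hnv hm hvA hnT hnC
  · exact hC.linked_of_common_child hhom.augGraph_asymm hmv hnv hvA hm hnT hnC

theorem BackdoorCriterion.src_mem_outcomeNodes
    (hC : BackdoorCriterion (𝒜.augGraph M) (Sum.inl '' T) Y C) (hhom : 𝒜.Homogeneous M)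
    {k : 𝒜.Idx} (hk : .inr k ∈ outcomeNodes M 𝒜 T Y C)
    (hkA : .inr k ∈ relevantNodes M 𝒜 T Y C) {w : D.GVar} (hw : w ∈ 𝒜.src k) (hwT : w ∉ T)
    (hwC : .inl w ∉ C) : .inl w ∈ outcomeNodes M 𝒜 T Y C :=
  hC.linked_of_child (u := .inl w) (v := .inr k) hhom.augGraph_asymm hw hk hkA
    (by simpa using hwT) hwC

theorem BackdoorCriterion.agg_mem_outcomeNodes
    (hC : BackdoorCriterion (𝒜.augGraph M) (Sum.inl '' T) Y C) (hhom : 𝒜.Homogeneous M)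
    {k : 𝒜.Idx} (hkC : .inr k ∉ C) {w : D.GVar} (hw : w ∈ 𝒜.src k)
    (hwR : .inl w ∈ outcomeNodes M 𝒜 T Y C) : .inr k ∈ outcomeNodes M 𝒜 T Y C :=
  linked_of_parent (u := .inl w) (v := .inr k) hhom.augGraph_asymm hw hwR
    (fun h => hC.notMem_linked h hwR) hkC

/-- The unobserved sources of an observed aggregate are all linked to the outcomes or all not. -/
theorem BackdoorCriterion.src_mem_outcomeNodes_of_mem
    (hC : BackdoorCriterion (𝒜.augGraph M) (Sum.inl '' T) Y C) (hhom : 𝒜.Homogeneous M)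
    {k : 𝒜.Idx} (hkC : .inr k ∈ C) {w w' : D.GVar} (hw : w ∈ 𝒜.src k) (hw' : w' ∈ 𝒜.src k)
    (hwR : .inl w ∈ outcomeNodes M 𝒜 T Y C) (hwC' : .inl w' ∉ C) :
    .inl w' ∈ outcomeNodes M 𝒜 T Y C :=
  hC.linked_of_common_child (u := .inl w) (w := .inl w') (d := .inr k) hhom.augGraph_asymm hw hw'
    (mem_relevantNodes (Or.inr hkC)) hwR (by simpa using hC.notMem_of_mem_src hkC hw') hwC'

/-- A ground parent of a mechanism on the outcome side is treated, on the outcome side as well, or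
not affected by the treatments. -/
theorem BackdoorCriterion.pa_of_mem_outcomeSide
    (hC : BackdoorCriterion (𝒜.augGraph M) (Sum.inl '' T) Y C) (hhom : 𝒜.Homogeneous M)
    {v w : D.GVar} (hv : v ∈ outcomeSide M 𝒜 T Y C) (hvA : .inl v ∈ relevantNodes M 𝒜 T Y C)
    (hwv : w ∈ M.pa v) (hwT : w ∉ T) :
    w ∈ outcomeSide M 𝒜 T Y C ∨ ∀ b ∈ T, ¬ IsDescendant (𝒜.augGraph M) (.inl b) (.inl w) := by
  by_cases hwC : .inl w ∈ C
  · exact Or.inr fun b hb => hC.not_isDescendant_inl hb hwC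
  obtain h | ⟨k, hk, h⟩ := M.adj_or_exists_agg 𝒜 hwv
  · exact Or.inl (mem_outcomeSide
      (hC.parent_mem_outcomeNodes hhom hv hvA h (by simpa using hwT) hwC))
  by_cases hkC : .inr k ∈ C
  · exact Or.inr fun b hb hbw =>
      hC.not_isDescendant_inl hb hkC (hbw.trans (isDescendant_of_mem_src hk))
  · exact Or.inl (mem_outcomeSide (hC.src_mem_outcomeNodes hhom
      (hC.parent_mem_outcomeNodes hhom hv hvA h (by simp) hkC)
      (relevantNodes_of_isDescendant (.single h) hvA) hk hwT hwC))

theorem BackdoorCriterion.pa_of_notMem_outcomeSide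
    (hC : BackdoorCriterion (𝒜.augGraph M) (Sum.inl '' T) Y C) (hhom : 𝒜.Homogeneous M)
    {v w : D.GVar} (hv : v ∉ outcomeSide M 𝒜 T Y C) (hwv : w ∈ M.pa v) :
    w ∉ outcomeSide M 𝒜 T Y C ∨ ∀ b ∈ T, ¬ IsDescendant (𝒜.augGraph M) (.inl b) (.inl w) := by
  by_cases hwC : .inl w ∈ C
  · exact Or.inr fun b hb => hC.not_isDescendant_inl hb hwC
  obtain h | ⟨k, hk, h⟩ := M.adj_or_exists_agg 𝒜 hwv
  · exact Or.inl fun hw =>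
      hv ⟨_, hC.mem_outcomeNodes_of_mem_outcomeSide hhom hw hwC, Or.inr h⟩
  by_cases hkC : .inr k ∈ C
  · exact Or.inr fun b hb hbw =>
      hC.not_isDescendant_inl hb hkC (hbw.trans (isDescendant_of_mem_src hk))
  · exact Or.inl fun hw => hv ⟨_, hC.agg_mem_outcomeNodes hhom hkC hk
      (hC.mem_outcomeNodes_of_mem_outcomeSide hhom hw hwC), Or.inr h⟩

variable (M 𝒜 T Y C)

open Classical in
/-- The world `a` on the ground variables linked to the outcomes, with the treatments set as in `x`
and all other variables set as in the reference world `r`. -/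
noncomputable def outcomePatch (x r a : D.World) : D.World :=
  T.piecewise x ((Sum.inl ⁻¹' outcomeNodes M 𝒜 T Y C).piecewise a r)

open Classical in
/-- The world `a` with the observed variables and those linked to the outcomes set as in the
reference world `r`. -/
noncomputable def treatmentPatch (r a : D.World) : D.World :=
  (Sum.inl ⁻¹' (outcomeNodes M 𝒜 T Y C ∪ C)).piecewise r a

variable {M 𝒜 T Y C}

theorem measurable_piecewise_world (s : Set D.GVar) [DecidablePred (· ∈ s)]
    {f g : D.World → D.World} (hf : Measurable f) (hg : Measurable g) :
    Measurable fun a => s.piecewise (f a) (g a) := by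
  refine measurable_pi_lambda _ fun v => ?_
  by_cases hv : v ∈ s
  · simpa [hv, Function.comp_def] using (measurable_pi_apply v).comp hf
  · simpa [hv, Function.comp_def] using (measurable_pi_apply v).comp hg

theorem measurable_outcomePatch (x r : D.World) : Measurable (outcomePatch M 𝒜 T Y C x r) := by
  classical
  exact measurable_piecewise_world _ measurable_const
    (measurable_piecewise_world _ measurable_id measurable_const)

theorem measurable_treatmentPatch (r : D.World) : Measurable (treatmentPatch M 𝒜 T Y C r) := by
  classical
  exact measurable_piecewise_world _ measurable_const measurable_id

theorem outcomePatch_of_mem {x r a : D.World} {v : D.GVar} (hv : v ∈ T) :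
    outcomePatch M 𝒜 T Y C x r a v = x v := by
  simp [outcomePatch, hv]

theorem outcomePatch_of_mem_outcomeNodes {x r a : D.World} {v : D.GVar} (hvT : v ∉ T)
    (hv : .inl v ∈ outcomeNodes M 𝒜 T Y C) : outcomePatch M 𝒜 T Y C x r a v = a v := by
  simp [outcomePatch, hvT, hv]

theorem outcomePatch_of_notMem {x r a : D.World} {v : D.GVar} (hvT : v ∉ T)
    (hv : .inl v ∉ outcomeNodes M 𝒜 T Y C) : outcomePatch M 𝒜 T Y C x r a v = r v := by
  simp [outcomePatch, hvT, hv]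

theorem treatmentPatch_of_mem {r a : D.World} {v : D.GVar}
    (hv : .inl v ∈ outcomeNodes M 𝒜 T Y C ∨ .inl v ∈ C) :
    treatmentPatch M 𝒜 T Y C r a v = r v := by
  classical
  exact Set.piecewise_eq_of_mem _ _ _ hv

theorem treatmentPatch_of_notMem {r a : D.World} {v : D.GVar}
    (hv : .inl v ∉ outcomeNodes M 𝒜 T Y C) (hvC : .inl v ∉ C) :
    treatmentPatch M 𝒜 T Y C r a v = a v := by
  classical
  exact Set.piecewise_eq_of_notMem _ _ _ (not_or.mpr ⟨hv, hvC⟩)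

/-- For an observed aggregate, one of the two patches replaces none of its sources and the other all
of them, up to observed variables. -/
theorem BackdoorCriterion.patch_src
    (hC : BackdoorCriterion (𝒜.augGraph M) (Sum.inl '' T) Y C) (hhom : 𝒜.Homogeneous M)
    {x r a : D.World} (ha : ∀ v, .inl v ∈ C → a v = r v) {k : 𝒜.Idx} (hk : .inr k ∈ C) :
    (∀ w ∈ 𝒜.src k, outcomePatch M 𝒜 T Y C x r a w = a w ∧
        treatmentPatch M 𝒜 T Y C r a w = r w) ∨
      ∀ w ∈ 𝒜.src k, outcomePatch M 𝒜 T Y C x r a w = r w ∧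
        treatmentPatch M 𝒜 T Y C r a w = a w := by
  have hT : ∀ w ∈ 𝒜.src k, w ∉ T := fun w hw => hC.notMem_of_mem_src hk hw
  by_cases h : ∃ w ∈ 𝒜.src k, .inl w ∈ outcomeNodes M 𝒜 T Y C
  · obtain ⟨w, hw, hwR⟩ := h
    refine Or.inl fun w' hw' => ?_
    by_cases hwC : .inl w' ∈ C
    · rw [outcomePatch_of_notMem (hT w' hw') fun h => h.1 hwC, treatmentPatch_of_mem (Or.inr hwC)]
      exact ⟨(ha w' hwC).symm, rfl⟩
    · have hR := hC.src_mem_outcomeNodes_of_mem hhom hk hw hw' hwR hwC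
      exact ⟨outcomePatch_of_mem_outcomeNodes (hT w' hw') hR, treatmentPatch_of_mem (Or.inl hR)⟩
  · push Not at h
    refine Or.inr fun w hw => ⟨outcomePatch_of_notMem (hT w hw) (h w hw), ?_⟩
    by_cases hwC : .inl w ∈ C
    · rw [treatmentPatch_of_mem (Or.inr hwC), ha w hwC]
    · exact treatmentPatch_of_notMem (h w hw) hwC

open Classical in
/-- On worlds with the observed values of the covariates, the outcome patch does not change the
values of the nodes linked to the outcomes. -/
theorem BackdoorCriterion.value_outcomePatch
    (hC : BackdoorCriterion (𝒜.augGraph M) (Sum.inl '' T) Y C) (hhom : 𝒜.Homogeneous M)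
    {x r a : D.World} (ha : ∀ n ∈ C, 𝒜.value a n = 𝒜.value r n) {n : 𝒜.Node}
    (hnA : n ∈ relevantNodes M 𝒜 T Y C)
    (hn : n ∉ Sum.inl '' T → n ∉ C → n ∈ outcomeNodes M 𝒜 T Y C) :
    𝒜.value (T.piecewise x a) n = 𝒜.value (outcomePatch M 𝒜 T Y C x r a) n := by
  have haC : ∀ v, .inl v ∈ C → a v = r v := fun v hv => ha (.inl v) hv
  have hground : ∀ v, (v ∉ T → .inl v ∉ C → .inl v ∈ outcomeNodes M 𝒜 T Y C) →
      (T.piecewise x a) v = outcomePatch M 𝒜 T Y C x r a v := by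
    intro v hv
    by_cases hvT : v ∈ T
    · rw [outcomePatch_of_mem hvT, Set.piecewise_eq_of_mem _ _ _ hvT]
    rw [Set.piecewise_eq_of_notMem _ _ _ hvT]
    by_cases hvC : .inl v ∈ C
    · rw [outcomePatch_of_notMem hvT fun h => h.1 hvC, haC v hvC]
    · rw [outcomePatch_of_mem_outcomeNodes hvT (hv hvT hvC)]
  rcases n with v | k
  · exact hground v fun hvT hvC => hn (by simpa using hvT) hvC
  by_cases hkC : .inr k ∈ C
  · have h1 : 𝒜.value (T.piecewise x a) (.inr k) = 𝒜.value a (.inr k) :=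
      𝒜.value_inr_congr fun w hw =>
        Set.piecewise_eq_of_notMem _ _ _ (hC.notMem_of_mem_src hkC hw)
    rw [h1]
    obtain h | h := hC.patch_src hhom (x := x) haC hkC
    · exact 𝒜.value_inr_congr fun w hw => (h w hw).1.symm
    · rw [ha _ hkC]
      exact 𝒜.value_inr_congr fun w hw => (h w hw).1.symm
  · exact 𝒜.value_inr_congr fun w hw => hground w fun hwT hwC =>
      hC.src_mem_outcomeNodes hhom (hn (by simp) hkC) hnA hw hwT hwC

/-- On worlds with the observed values of the covariates, the treatment patch does not change the
values of the nodes that are not linked to the outcomes. -/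
theorem BackdoorCriterion.value_treatmentPatch
    (hC : BackdoorCriterion (𝒜.augGraph M) (Sum.inl '' T) Y C) (hhom : 𝒜.Homogeneous M)
    {r a : D.World} (ha : ∀ n ∈ C, 𝒜.value a n = 𝒜.value r n) {n : 𝒜.Node}
    (hn : n ∉ outcomeNodes M 𝒜 T Y C) :
    𝒜.value a n = 𝒜.value (treatmentPatch M 𝒜 T Y C r a) n := by
  have haC : ∀ v, .inl v ∈ C → a v = r v := fun v hv => ha (.inl v) hv
  have hground : ∀ v, .inl v ∉ outcomeNodes M 𝒜 T Y C →
      a v = treatmentPatch M 𝒜 T Y C r a v := by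
    intro v hv
    by_cases hvC : .inl v ∈ C
    · rw [treatmentPatch_of_mem (Or.inr hvC), haC v hvC]
    · rw [treatmentPatch_of_notMem hv hvC]
  rcases n with v | k
  · exact hground v hn
  by_cases hkC : .inr k ∈ C
  · obtain h | h := hC.patch_src hhom (x := r) haC hkC
    · rw [ha _ hkC]
      exact 𝒜.value_inr_congr fun w hw => (h w hw).2.symm
    · exact 𝒜.value_inr_congr fun w hw => (h w hw).2.symm
  · exact 𝒜.value_inr_congr fun w hw => hground w fun hwR =>
      hn (hC.agg_mem_outcomeNodes hhom hkC hw hwR)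

/-- The observed values of the covariates can be checked separately for the ground variables and,
through the two patches, for the aggregates. -/
theorem BackdoorCriterion.value_eq_iff
    (hC : BackdoorCriterion (𝒜.augGraph M) (Sum.inl '' T) Y C) (hhom : 𝒜.Homogeneous M)
    (x r a : D.World) :
    (∀ n ∈ C, 𝒜.value a n = 𝒜.value r n) ↔ (∀ v, .inl v ∈ C → a v = r v) ∧
      ∀ k, .inr k ∈ C →
        𝒜.value (outcomePatch M 𝒜 T Y C x r a) (.inr k) = 𝒜.value r (.inr k) ∧
        𝒜.value (treatmentPatch M 𝒜 T Y C r a) (.inr k) = 𝒜.value r (.inr k) := by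
  constructor
  · intro ha
    have haC : ∀ v, .inl v ∈ C → a v = r v := fun v hv => ha (.inl v) hv
    refine ⟨haC, fun k hk => ?_⟩
    obtain h | h := hC.patch_src hhom (x := x) haC hk
    · rw [𝒜.value_inr_congr fun w hw => (h w hw).1, 𝒜.value_inr_congr fun w hw => (h w hw).2]
      exact ⟨ha _ hk, rfl⟩
    · rw [𝒜.value_inr_congr fun w hw => (h w hw).1, 𝒜.value_inr_congr fun w hw => (h w hw).2]
      exact ⟨rfl, ha _ hk⟩
  · rintro ⟨haC, hk⟩ (v | k) hn
    · exact haC v hn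
    · obtain h | h := hC.patch_src hhom (x := x) haC hn
      · rw [← (hk k hn).1]
        exact 𝒜.value_inr_congr fun w hw => (h w hw).1.symm
      · rw [← (hk k hn).2]
        exact 𝒜.value_inr_congr fun w hw => (h w hw).2.symm

end Sides

/-! ### Factorization through the hybrid and the split model -/

section Factorization

variable {D : Database.{u}} (M : PRCM D)

/-- The noise vector of the structural equation of `v`. -/
def PRCM.noiseAt (v : D.GVar) (ε : ∀ e, M.Noise e) (e : M.paExo v) : M.Noise e.1 := ε e.1

/-- The law of the noise vector of the structural equation of `v`. -/
noncomputable def PRCM.noiseLaw (v : D.GVar) : Measure (∀ e : M.paExo v, M.Noise e.1) :=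
  M.prNoise.map (M.noiseAt v)

theorem PRCM.measurable_noiseAt (v : D.GVar) : Measurable (M.noiseAt v) :=
  measurable_pi_lambda _ fun e => measurable_pi_apply e.1

instance (v : D.GVar) : IsProbabilityMeasure (M.noiseLaw v) :=
  Measure.isProbabilityMeasure_map (M.measurable_noiseAt v).aemeasurable

theorem PRCM.Markovian.map_noiseAt [Fintype D.GVar] (hM : M.Markovian) :
    M.prNoise.map (fun ε v => M.noiseAt v ε) = Measure.pi M.noiseLaw :=
  (iIndepFun_iff_map_fun_eq_pi_map fun v => (M.measurable_noiseAt v).aemeasurable).1 hM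

theorem PRCM.map_eqn_noiseLaw (v : D.GVar) (a : D.World) :
    (M.noiseLaw v).map (fun η => M.eqn v (fun w => a w.1) η) =
      M.prNoise.map (fun ε => M.eqn v (fun w => a w.1) (fun e => ε e.1)) :=
  Measure.map_map ((M.measurable_eqn v).comp (measurable_const.prodMk measurable_id))
    (M.measurable_noiseAt v)

open Classical in
/-- The mechanisms of `M` for the variables in `S`, where the mechanism of `v` reads the world
`P v a` instead of `a`; the variables outside `S` are set to their values in `r`. -/
noncomputable def PRCM.patchedMech (S : Set D.GVar) (P : D.GVar → D.World → D.World)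
    (r : D.World) (v : D.GVar) (a : D.World) (η : ∀ e : M.paExo v, M.Noise e.1) : D.Dom v.1 :=
  if v ∈ S then M.eqn v (fun w => P v a w.1) η else r v

variable {M} in
theorem PRCM.isLocal_patchedMech {S : Set D.GVar} {P : D.GVar → D.World → D.World} {r : D.World}
    (hP : ∀ v a a' w, a w = a' w → P v a w = P v a' w) :
    IsLocal (fun w v => w ∈ M.pa v) (M.patchedMech S P r) := by
  intro v a a' h
  funext η
  unfold patchedMech
  have : (fun w : M.pa v => P v a w.1) = fun w : M.pa v => P v a' w.1 :=
    funext fun w => hP v a a' w.1 (h w.1 w.2)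
  rw [this]

variable {M} in
theorem PRCM.measurable_patchedMech {S : Set D.GVar} {P : D.GVar → D.World → D.World}
    {r : D.World} (hP : ∀ v, Measurable (P v)) (v : D.GVar) :
    Measurable fun z : D.World × (∀ e : M.paExo v, M.Noise e.1) =>
      M.patchedMech S P r v z.1 z.2 := by
  by_cases hv : v ∈ S
  · simp only [patchedMech, hv, if_true]
    exact (M.measurable_eqn v).comp ((measurable_pi_lambda _ fun w =>
      (measurable_pi_apply w.1).comp ((hP v).comp measurable_fst)).prodMk measurable_snd)
  · simp only [patchedMech, hv, if_false, measurable_const]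

variable (𝒜 : Aggregation D) (T : Set D.GVar) (Y C : Set 𝒜.Node)

open Classical in
/-- The mechanisms on the outcome side read the treatments as in `x`. -/
noncomputable def hybridPatch (x : D.World) (v : D.GVar) (a : D.World) : D.World :=
  if v ∈ outcomeSide M 𝒜 T Y C then T.piecewise x a else a

open Classical in
/-- The mechanisms on the outcome side read only variables linked to the outcomes, the other
mechanisms read only the remaining unobserved variables. -/
noncomputable def splitPatch (x r : D.World) (v : D.GVar) (a : D.World) : D.World :=
  if v ∈ outcomeSide M 𝒜 T Y C then outcomePatch M 𝒜 T Y C x r a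
  else treatmentPatch M 𝒜 T Y C r a

variable {M 𝒜 T Y C} in
open Classical in
theorem hybridPatch_of_mem {x : D.World} {v : D.GVar} (hv : v ∈ outcomeSide M 𝒜 T Y C) :
    hybridPatch M 𝒜 T Y C x v = fun a => T.piecewise x a := by
  funext a
  rw [hybridPatch, if_pos hv]

variable {M 𝒜 T Y C} in
theorem hybridPatch_of_notMem {x : D.World} {v : D.GVar} (hv : v ∉ outcomeSide M 𝒜 T Y C) :
    hybridPatch M 𝒜 T Y C x v = id := by
  funext a
  rw [hybridPatch, if_neg hv, id]

variable {M 𝒜 T Y C} in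
theorem splitPatch_of_mem {x r : D.World} {v : D.GVar} (hv : v ∈ outcomeSide M 𝒜 T Y C) :
    splitPatch M 𝒜 T Y C x r v = outcomePatch M 𝒜 T Y C x r := by
  funext a
  rw [splitPatch, if_pos hv]

variable {M 𝒜 T Y C} in
theorem splitPatch_of_notMem {x r : D.World} {v : D.GVar} (hv : v ∉ outcomeSide M 𝒜 T Y C) :
    splitPatch M 𝒜 T Y C x r v = treatmentPatch M 𝒜 T Y C r := by
  funext a
  rw [splitPatch, if_neg hv]

/-- The hybrid model: one world that follows the post-update equations on the outcome side and the
pre-update equations elsewhere, using every noise vector once. -/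
noncomputable def hybridMech (x r : D.World) :=
  M.patchedMech (Sum.inl ⁻¹' relevantNodes M 𝒜 T Y C) (hybridPatch M 𝒜 T Y C x) r

/-- The split model: the hybrid model with every interaction between the outcome side and the rest
cut, by fixing the values of the other side to those of the reference world `r`. -/
noncomputable def splitMech (x r : D.World) :=
  M.patchedMech (Sum.inl ⁻¹' relevantNodes M 𝒜 T Y C) (splitPatch M 𝒜 T Y C x r) r

variable {M 𝒜 T Y C}

theorem isLocal_hybridMech (x r : D.World) :
    IsLocal (fun w v => w ∈ M.pa v) (hybridMech M 𝒜 T Y C x r) := by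
  refine PRCM.isLocal_patchedMech fun v a a' w h => ?_
  by_cases hv : v ∈ outcomeSide M 𝒜 T Y C <;> by_cases hw : w ∈ T <;>
    simp [hybridPatch, hv, hw, h]

theorem isLocal_splitMech (x r : D.World) :
    IsLocal (fun w v => w ∈ M.pa v) (splitMech M 𝒜 T Y C x r) := by
  refine PRCM.isLocal_patchedMech fun v a a' w h => ?_
  by_cases hv : v ∈ outcomeSide M 𝒜 T Y C
  · simp only [splitPatch_of_mem hv, outcomePatch, Set.piecewise, h]
  · simp only [splitPatch_of_notMem hv, treatmentPatch, Set.piecewise, h]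

theorem measurable_hybridMech (x r : D.World) (v : D.GVar) :
    Measurable fun z : D.World × (∀ e : M.paExo v, M.Noise e.1) =>
      hybridMech M 𝒜 T Y C x r v z.1 z.2 := by
  classical
  refine PRCM.measurable_patchedMech (fun v => ?_) v
  by_cases hv : v ∈ outcomeSide M 𝒜 T Y C
  · rw [hybridPatch_of_mem hv]
    exact measurable_piecewise_world T measurable_const measurable_id
  · rw [hybridPatch_of_notMem hv]
    exact measurable_id

theorem measurable_splitMech (x r : D.World) (v : D.GVar) :
    Measurable fun z : D.World × (∀ e : M.paExo v, M.Noise e.1) =>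
      splitMech M 𝒜 T Y C x r v z.1 z.2 := by
  refine PRCM.measurable_patchedMech (fun v => ?_) v
  by_cases hv : v ∈ outcomeSide M 𝒜 T Y C
  · rw [splitPatch_of_mem hv]
    exact measurable_outcomePatch x r
  · rw [splitPatch_of_notMem hv]
    exact measurable_treatmentPatch r

/-- The hybrid world agrees with the post-update world on the outcome side and with the pre-update
world elsewhere. -/
theorem BackdoorCriterion.hybrid_eq
    (hC : BackdoorCriterion (𝒜.augGraph M) (Sum.inl '' T) Y C) (hhom : 𝒜.Homogeneous M)
    (x r : D.World) (ε : ∀ e, M.Noise e) {z : D.World}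
    (hz : IsSolution (hybridMech M 𝒜 T Y C x r) (fun v => M.noiseAt v ε) z) (v : D.GVar)
    (hvA : .inl v ∈ relevantNodes M 𝒜 T Y C) :
    (v ∈ outcomeSide M 𝒜 T Y C → z v = M.solve T x ε v) ∧
      (v ∉ outcomeSide M 𝒜 T Y C → z v = M.solve ∅ D.inst ε v) := by
  classical
  induction v using M.wf.induction with
  | _ v ih =>
    have ih' : ∀ w ∈ M.pa v, (w ∈ outcomeSide M 𝒜 T Y C → z w = M.solve T x ε w) ∧
        (w ∉ outcomeSide M 𝒜 T Y C → z w = M.solve ∅ D.inst ε w) := fun w hw =>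
      ih w hw (relevantNodes_of_isDescendant (isDescendant_of_mem_pa 𝒜 hw) hvA)
    have hzv := hz v
    rw [hybridMech, PRCM.patchedMech,
      if_pos (show v ∈ Sum.inl ⁻¹' relevantNodes M 𝒜 T Y C from hvA)] at hzv
    refine ⟨fun hv => ?_, fun hv => ?_⟩
    · have hvT : v ∉ T := fun h => hC.notMem_outcomeSide hhom h hv
      rw [hzv, M.solve_eq, if_neg hvT]
      congr 1
      funext ⟨w, hw⟩
      rw [hybridPatch_of_mem hv]
      change T.piecewise x z w = M.solve T x ε w
      by_cases hwT : w ∈ T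
      · rw [Set.piecewise_eq_of_mem _ _ _ hwT, M.solve_eq, if_pos hwT]
      rw [Set.piecewise_eq_of_notMem _ _ _ hwT]
      by_cases hws : w ∈ outcomeSide M 𝒜 T Y C
      · exact (ih' w hw).1 hws
      · rw [(ih' w hw).2 hws]
        exact M.solve_eq_of_not_isDescendant 𝒜 T x ε w
          ((hC.pa_of_mem_outcomeSide hhom hv hvA hw hwT).resolve_left hws)
    · rw [hzv, M.solve_eq, if_neg (Set.notMem_empty v)]
      congr 1
      funext ⟨w, hw⟩
      rw [hybridPatch_of_notMem hv, id]
      by_cases hws : w ∈ outcomeSide M 𝒜 T Y C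
      · rw [(ih' w hw).1 hws]
        exact (M.solve_eq_of_not_isDescendant 𝒜 T x ε w
          ((hC.pa_of_notMem_outcomeSide hhom hv hw).resolve_left (not_not_intro hws))).symm
      · exact (ih' w hw).2 hws

theorem PRCM.value_solve_eq_of_mem (M : PRCM D) {𝒜 : Aggregation D} {T : Set D.GVar}
    {Y C : Set 𝒜.Node} (hC : BackdoorCriterion (𝒜.augGraph M) (Sum.inl '' T) Y C)
    (x : D.World) (ε : ∀ e, M.Noise e) {n : 𝒜.Node} (hn : n ∈ C) :
    𝒜.value (M.solve ∅ D.inst ε) n = 𝒜.value (M.solve T x ε) n := by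
  rcases n with v | k
  · exact M.solve_eq_of_not_isDescendant 𝒜 T x ε v fun b hb => hC.not_isDescendant_inl hb hn
  · exact 𝒜.value_inr_congr fun w hw => M.solve_eq_of_not_isDescendant 𝒜 T x ε w
      fun b hb h => hC.not_isDescendant_inl hb hn (h.trans (isDescendant_of_mem_src hw))

/-- The hybrid world carries the pre-update treatments and covariates. -/
theorem BackdoorCriterion.hybrid_eq_of_mem
    (hC : BackdoorCriterion (𝒜.augGraph M) (Sum.inl '' T) Y C) (hhom : 𝒜.Homogeneous M)
    (x r : D.World) (ε : ∀ e, M.Noise e) {z : D.World}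
    (hz : IsSolution (hybridMech M 𝒜 T Y C x r) (fun v => M.noiseAt v ε) z) {v : D.GVar}
    (hv : v ∈ T) : z v = M.solve ∅ D.inst ε v :=
  (hC.hybrid_eq hhom x r ε hz v (mem_relevantNodes
    (Or.inl (Or.inl (Set.mem_image_of_mem _ hv))))).2 (hC.notMem_outcomeSide hhom hv)

theorem BackdoorCriterion.hybrid_eq_of_not_isDescendant
    (hC : BackdoorCriterion (𝒜.augGraph M) (Sum.inl '' T) Y C) (hhom : 𝒜.Homogeneous M)
    (x r : D.World) (ε : ∀ e, M.Noise e) {z : D.World}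
    (hz : IsSolution (hybridMech M 𝒜 T Y C x r) (fun v => M.noiseAt v ε) z) {v : D.GVar}
    (hvA : .inl v ∈ relevantNodes M 𝒜 T Y C)
    (hv : ∀ b ∈ T, ¬ IsDescendant (𝒜.augGraph M) (.inl b) (.inl v)) :
    z v = M.solve T x ε v := by
  by_cases hvs : v ∈ outcomeSide M 𝒜 T Y C
  · exact (hC.hybrid_eq hhom x r ε hz v hvA).1 hvs
  · rw [(hC.hybrid_eq hhom x r ε hz v hvA).2 hvs]
    exact M.solve_eq_of_not_isDescendant 𝒜 T x ε v hv

theorem BackdoorCriterion.value_hybrid_of_mem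
    (hC : BackdoorCriterion (𝒜.augGraph M) (Sum.inl '' T) Y C) (hhom : 𝒜.Homogeneous M)
    (x r : D.World) (ε : ∀ e, M.Noise e) {z : D.World}
    (hz : IsSolution (hybridMech M 𝒜 T Y C x r) (fun v => M.noiseAt v ε) z) {n : 𝒜.Node}
    (hn : n ∈ C) : 𝒜.value z n = 𝒜.value (M.solve ∅ D.inst ε) n := by
  rw [M.value_solve_eq_of_mem hC x ε hn]
  rcases n with v | k
  · exact hC.hybrid_eq_of_not_isDescendant hhom x r ε hz (mem_relevantNodes (Or.inr hn))
      fun b hb => hC.not_isDescendant_inl hb hn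
  · exact 𝒜.value_inr_congr fun w hw => hC.hybrid_eq_of_not_isDescendant hhom x r ε hz
      (relevantNodes_of_isDescendant (isDescendant_of_mem_src hw) (mem_relevantNodes (Or.inr hn)))
      fun b hb h => hC.not_isDescendant_inl hb hn (h.trans (isDescendant_of_mem_src hw))

open Classical in
/-- The hybrid world, with the treatments set as in `x`, carries the post-update outcomes. -/
theorem BackdoorCriterion.value_hybrid_outcome
    (hC : BackdoorCriterion (𝒜.augGraph M) (Sum.inl '' T) Y C) (hhom : 𝒜.Homogeneous M)
    (x r : D.World) (ε : ∀ e, M.Noise e) {z : D.World}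
    (hz : IsSolution (hybridMech M 𝒜 T Y C x r) (fun v => M.noiseAt v ε) z) {n : 𝒜.Node}
    (hn : n ∈ Y) : 𝒜.value (T.piecewise x z) n = 𝒜.value (M.solve T x ε) n := by
  have hnA : n ∈ relevantNodes M 𝒜 T Y C := mem_relevantNodes (Or.inl (Or.inr hn))
  have hground : ∀ v, .inl v ∈ relevantNodes M 𝒜 T Y C →
      (v ∉ T → .inl v ∉ C → .inl v ∈ outcomeNodes M 𝒜 T Y C) →
      (T.piecewise x z) v = M.solve T x ε v := by
    intro v hvA hv
    by_cases hvT : v ∈ T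
    · rw [Set.piecewise_eq_of_mem _ _ _ hvT, M.solve_eq, if_pos hvT]
    rw [Set.piecewise_eq_of_notMem _ _ _ hvT]
    by_cases hvC : .inl v ∈ C
    · exact hC.hybrid_eq_of_not_isDescendant hhom x r ε hz hvA
        fun b hb => hC.not_isDescendant_inl hb hvC
    · exact (hC.hybrid_eq hhom x r ε hz v hvA).1 (mem_outcomeSide (hv hvT hvC))
  rcases n with v | k
  · exact hground v hnA fun hvT _ => hC.mem_outcomeNodes_of_mem hn (by simpa using hvT)
  · exact 𝒜.value_inr_congr fun w hw => hground w
      (relevantNodes_of_isDescendant (isDescendant_of_mem_src hw) hnA) fun hwT hwC =>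
      hC.src_mem_outcomeNodes hhom (hC.mem_outcomeNodes_of_mem hn (by simp)) hnA hw hwT hwC

/-- On worlds with the observed values of the covariates, the mechanisms of the hybrid and of the
split model have the same laws: the patches do not change the values of the parents in the augmented
graph, on which alone the law depends. -/
theorem BackdoorCriterion.map_hybridMech_eq
    (hC : BackdoorCriterion (𝒜.augGraph M) (Sum.inl '' T) Y C) (hhom : 𝒜.Homogeneous M)
    (hsum : 𝒜.DistributionPreserving M) (x r : D.World) (v : D.GVar) {a : D.World}
    (ha : ∀ n ∈ C, 𝒜.value a n = 𝒜.value r n) :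
    (M.noiseLaw v).map (hybridMech M 𝒜 T Y C x r v a) =
      (M.noiseLaw v).map (splitMech M 𝒜 T Y C x r v a) := by
  by_cases hvA : v ∈ Sum.inl ⁻¹' relevantNodes M 𝒜 T Y C
  swap
  · congr 1
    funext η
    simp only [hybridMech, splitMech, PRCM.patchedMech, hvA, if_false]
  have h1 : ∀ P : D.GVar → D.World → D.World,
      (M.noiseLaw v).map (M.patchedMech (Sum.inl ⁻¹' relevantNodes M 𝒜 T Y C) P r v a) =
        M.prNoise.map (fun ε => M.eqn v (fun w => P v a w.1) (fun e => ε e.1)) := by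
    intro P
    rw [← M.map_eqn_noiseLaw v (P v a)]
    congr 1
    funext η
    rw [PRCM.patchedMech, if_pos hvA]
  rw [hybridMech, splitMech, h1, h1]
  refine hsum v _ _ fun n hn => ?_
  by_cases hv : v ∈ outcomeSide M 𝒜 T Y C
  · simp only [hybridPatch_of_mem hv, splitPatch_of_mem hv]
    exact hC.value_outcomePatch hhom ha (relevantNodes_of_isDescendant (.single hn) hvA)
      (hC.parent_mem_outcomeNodes hhom hv hvA hn)
  · simp only [hybridPatch_of_notMem hv, splitPatch_of_notMem hv, id]
    exact hC.value_treatmentPatch hhom ha fun h => hv ⟨n, h, Or.inr hn⟩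

theorem splitMech_eq_of_outcomeSide {x r : D.World} {q q' : ∀ v, ∀ e : M.paExo v, M.Noise e.1}
    {z z' : D.World} (hz : IsSolution (splitMech M 𝒜 T Y C x r) q z)
    (hz' : IsSolution (splitMech M 𝒜 T Y C x r) q' z')
    (h : ∀ v ∈ outcomeSide M 𝒜 T Y C, q v = q' v) (v : D.GVar)
    (hv : v ∈ outcomeSide M 𝒜 T Y C) : z v = z' v := by
  induction v using M.wf.induction with
  | _ v ih =>
    rw [hz v, hz' v, h v hv, splitMech, PRCM.patchedMech, PRCM.patchedMech]
    congr 2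
    funext ⟨w, hw⟩
    rw [splitPatch_of_mem hv]
    by_cases hwT : w ∈ T
    · rw [outcomePatch_of_mem hwT, outcomePatch_of_mem hwT]
    by_cases hwR : .inl w ∈ outcomeNodes M 𝒜 T Y C
    · rw [outcomePatch_of_mem_outcomeNodes hwT hwR, outcomePatch_of_mem_outcomeNodes hwT hwR]
      exact ih w hw (mem_outcomeSide hwR)
    · rw [outcomePatch_of_notMem hwT hwR, outcomePatch_of_notMem hwT hwR]

theorem BackdoorCriterion.splitMech_eq_of_notMem_outcomeSide
    (hC : BackdoorCriterion (𝒜.augGraph M) (Sum.inl '' T) Y C) (hhom : 𝒜.Homogeneous M)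
    {x r : D.World} {q q' : ∀ v, ∀ e : M.paExo v, M.Noise e.1}
    {z z' : D.World} (hz : IsSolution (splitMech M 𝒜 T Y C x r) q z)
    (hz' : IsSolution (splitMech M 𝒜 T Y C x r) q' z')
    (h : ∀ v, v ∉ outcomeSide M 𝒜 T Y C → q v = q' v) (v : D.GVar)
    (hv : v ∉ outcomeSide M 𝒜 T Y C) : z v = z' v := by
  induction v using M.wf.induction with
  | _ v ih =>
    rw [hz v, hz' v, h v hv, splitMech, PRCM.patchedMech, PRCM.patchedMech]
    congr 2
    funext ⟨w, hw⟩
    rw [splitPatch_of_notMem hv]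
    by_cases hwR : .inl w ∈ outcomeNodes M 𝒜 T Y C ∨ .inl w ∈ C
    · rw [treatmentPatch_of_mem hwR, treatmentPatch_of_mem hwR]
    · rw [not_or] at hwR
      rw [treatmentPatch_of_notMem hwR.1 hwR.2, treatmentPatch_of_notMem hwR.1 hwR.2]
      exact ih w hw fun hws => hwR.1 (hC.mem_outcomeNodes_of_mem_outcomeSide hhom hws hwR.2)

/-- Factorization: on the event that the covariates have the values of the reference world `r`, the
joint law of the pre-update treatments and the post-update outcomes is a product. -/
theorem BackdoorCriterion.exists_factorization
    (hC : BackdoorCriterion (𝒜.augGraph M) (Sum.inl '' T) Y C) (hhom : 𝒜.Homogeneous M)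
    (hM : M.Markovian) (hsum : 𝒜.DistributionPreserving M) (x r : D.World) :
    ∃ κ ρ : Set D.World → ENNReal, ∀ Θ E : Set D.World, MeasurableSet Θ → MeasurableSet E →
      (∀ a a' : D.World, (∀ v ∈ T, a v = a' v) → a ∈ Θ → a' ∈ Θ) →
      (∀ a a' : D.World, (∀ n ∈ Y, 𝒜.value a n = 𝒜.value a' n) → a ∈ E → a' ∈ E) →
      M.prNoise {ε | M.solve ∅ D.inst ε ∈ Θ ∧
        (∀ n : C, 𝒜.value (M.solve ∅ D.inst ε) n.1 = 𝒜.value r n.1) ∧ M.solve T x ε ∈ E} =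
      κ Θ * ρ E := by
  classical
  have : Fintype D.GVar := Fintype.ofFinite _
  let Z := solution M.wf r (splitMech M 𝒜 T Y C x r)
  have hZ : ∀ q, IsSolution (splitMech M 𝒜 T Y C x r) q (Z q) := fun q =>
    isSolution_solution M.wf r (isLocal_splitMech x r) q
  have hZm : Measurable Z := measurable_solution M.wf r (measurable_splitMech x r)
  let o : D.World → D.World := outcomePatch M 𝒜 T Y C x r
  let t : D.World → D.World := treatmentPatch M 𝒜 T Y C r
  have hom : Measurable o := measurable_outcomePatch x r
  have htm : Measurable t := measurable_treatmentPatch r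
  -- `L` and `R` check the observed covariates of the treatment and of the outcome part; an observed
  -- aggregate is checked in both, one of the two checks being trivial
  let L : Set D.World → Set D.World := fun Θ =>
    Θ ∩ {a | ∀ v, v ∉ outcomeSide M 𝒜 T Y C → .inl v ∈ C → a v = r v} ∩
      {a | ∀ k, .inr k ∈ C → 𝒜.value (t a) (.inr k) = 𝒜.value r (.inr k)}
  let R : Set D.World → Set D.World := fun E =>
    o ⁻¹' E ∩ {a | ∀ v, v ∈ outcomeSide M 𝒜 T Y C → .inl v ∈ C → a v = r v} ∩
      {a | ∀ k, .inr k ∈ C → 𝒜.value (o a) (.inr k) = 𝒜.value r (.inr k)}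
  refine ⟨fun Θ => Measure.pi M.noiseLaw (Z ⁻¹' L Θ),
    fun E => Measure.pi M.noiseLaw (Z ⁻¹' R E), fun Θ E hΘ hE hΘT hEY => ?_⟩
  have hground : ∀ p : D.GVar → Prop,
      MeasurableSet {a : D.World | ∀ v, p v → .inl v ∈ C → a v = r v} := by
    intro p
    simp only [Set.ofPred_forall]
    exact MeasurableSet.iInter fun v => MeasurableSet.iInter fun _ => MeasurableSet.iInter fun _ =>
      (measurableSet_singleton (r v)).preimage (measurable_pi_apply v)
  have hagg : ∀ f : D.World → D.World, Measurable f → MeasurableSet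
      {a : D.World | ∀ k, .inr k ∈ C → 𝒜.value (f a) (.inr k) = 𝒜.value r (.inr k)} := by
    intro f hf
    simp only [Set.ofPred_forall]
    exact MeasurableSet.iInter fun k => MeasurableSet.iInter fun _ =>
      ((𝒜.measurable_value (.inr k)).comp hf) (measurableSet_singleton (𝒜.value r (.inr k)))
  have hL : MeasurableSet (L Θ) := (hΘ.inter (hground _)).inter (hagg t htm)
  have hR : MeasurableSet (R E) := ((hom hE).inter (hground _)).inter (hagg o hom)
  let F : Set D.World := {a | a ∈ Θ ∧ (∀ n : C, 𝒜.value a n.1 = 𝒜.value r n.1) ∧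
    T.piecewise x a ∈ E}
  have hF : MeasurableSet F := hΘ.inter ((𝒜.measurableSet_value_eq C fun n => 𝒜.value r n.1).inter
    (measurable_piecewise_world T measurable_const measurable_id hE))
  have hFLR : F = L Θ ∩ R E := by
    ext a
    have hiff := hC.value_eq_iff hhom x r a
    constructor
    · rintro ⟨h1, h2, h3⟩
      have h2' : ∀ n ∈ C, 𝒜.value a n = 𝒜.value r n := fun n hn => h2 ⟨n, hn⟩
      obtain ⟨h4, h5⟩ := hiff.1 h2'
      refine ⟨⟨⟨h1, fun v _ => h4 v⟩, fun k hk => (h5 k hk).2⟩,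
        ⟨⟨hEY _ _ (fun n hn => ?_) h3, fun v _ => h4 v⟩, fun k hk => (h5 k hk).1⟩⟩
      exact hC.value_outcomePatch hhom h2' (mem_relevantNodes (Or.inl (Or.inr hn)))
        fun hnT _ => hC.mem_outcomeNodes_of_mem hn hnT
    · rintro ⟨⟨⟨h1, h2⟩, h3⟩, ⟨⟨h4, h5⟩, h6⟩⟩
      have h7 : ∀ n ∈ C, 𝒜.value a n = 𝒜.value r n :=
        hiff.2 ⟨fun v hv => by
          by_cases hvs : v ∈ outcomeSide M 𝒜 T Y C
          · exact h5 v hvs hv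
          · exact h2 v hvs hv, fun k hk => ⟨h6 k hk, h3 k hk⟩⟩
      refine ⟨h1, fun n => h7 n.1 n.2, hEY _ _ (fun n hn => ?_) h4⟩
      exact (hC.value_outcomePatch hhom h7 (mem_relevantNodes (Or.inl (Or.inr hn)))
        fun hnT _ => hC.mem_outcomeNodes_of_mem hn hnT).symm
  let H := solution M.wf r (hybridMech M 𝒜 T Y C x r)
  have hHm : Measurable H := measurable_solution M.wf r (measurable_hybridMech x r)
  have hevent : {ε | M.solve ∅ D.inst ε ∈ Θ ∧
        (∀ n : C, 𝒜.value (M.solve ∅ D.inst ε) n.1 = 𝒜.value r n.1) ∧ M.solve T x ε ∈ E} =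
      (fun ε v => M.noiseAt v ε) ⁻¹' (H ⁻¹' F) := by
    ext ε
    have hz : IsSolution (hybridMech M 𝒜 T Y C x r) (fun v => M.noiseAt v ε)
        (H fun v => M.noiseAt v ε) := isSolution_solution M.wf r (isLocal_hybridMech x r) _
    refine and_congr ⟨hΘT _ _ fun v hv => ?_, hΘT _ _ fun v hv => ?_⟩
      (and_congr (forall_congr' fun n => ?_) ⟨hEY _ _ fun n hn => ?_, hEY _ _ fun n hn => ?_⟩)
    · exact (hC.hybrid_eq_of_mem hhom x r ε hz hv).symm
    · exact hC.hybrid_eq_of_mem hhom x r ε hz hv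
    · rw [← hC.value_hybrid_of_mem hhom x r ε hz n.2]
    · exact (hC.value_hybrid_outcome hhom x r ε hz hn).symm
    · exact hC.value_hybrid_outcome hhom x r ε hz hn
  have hblocks : Measurable fun (ε : ∀ e, M.Noise e) v => M.noiseAt v ε :=
    measurable_pi_lambda _ fun v => M.measurable_noiseAt v
  rw [hevent, ← Measure.map_apply hblocks (hHm hF), hM.map_noiseAt,
    measure_solution_congr M.wf r M.acyclic (isLocal_hybridMech x r) (isLocal_splitMech x r)
      (measurable_hybridMech x r) (measurable_splitMech x r) M.noiseLaw hF
      (fun v a ha => hC.map_hybridMech_eq hhom hsum x r v fun n hn => ha.2.1 ⟨n, hn⟩),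
    hFLR, Set.inter_comm, Set.preimage_inter, mul_comm]
  refine measure_pi_inter_of_dependsOn M.noiseLaw (outcomeSide M 𝒜 T Y C) (hZm hR) (hZm hL)
    (fun q q' hqq => ?_) fun q q' hqq => ?_
  · have hzz := splitMech_eq_of_outcomeSide (hZ q) (hZ q') hqq
    have hoo : o (Z q) = o (Z q') := by
      funext w
      by_cases hwT : w ∈ T
      · simp only [o, outcomePatch_of_mem hwT]
      by_cases hwR : .inl w ∈ outcomeNodes M 𝒜 T Y C
      · simp only [o, outcomePatch_of_mem_outcomeNodes hwT hwR, hzz w (mem_outcomeSide hwR)]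
      · simp only [o, outcomePatch_of_notMem hwT hwR]
    rintro ⟨⟨h1, h2⟩, h3⟩
    refine ⟨⟨?_, fun v hv hvC => (hzz v hv).symm.trans (h2 v hv hvC)⟩, fun k hk => ?_⟩
    · change o (Z q') ∈ E
      rw [← hoo]
      exact h1
    · change 𝒜.value (o (Z q')) _ = _
      rw [← hoo]
      exact h3 k hk
  · have hzz := hC.splitMech_eq_of_notMem_outcomeSide hhom (hZ q) (hZ q') hqq
    have htt : t (Z q) = t (Z q') := by
      funext w
      by_cases hwR : .inl w ∈ outcomeNodes M 𝒜 T Y C ∨ .inl w ∈ C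
      · simp only [t, treatmentPatch_of_mem hwR]
      · rw [not_or] at hwR
        simp only [t, treatmentPatch_of_notMem hwR.1 hwR.2]
        exact hzz w fun hws => hwR.1 (hC.mem_outcomeNodes_of_mem_outcomeSide hhom hws hwR.2)
    rintro ⟨⟨h1, h2⟩, h3⟩
    refine ⟨⟨hΘT _ _ (fun v hv => hzz v (hC.notMem_outcomeSide hhom hv)) h1,
      fun v hv hvC => (hzz v hv).symm.trans (h2 v hv hvC)⟩, fun k hk => ?_⟩
    change 𝒜.value (t (Z q')) _ = _
    rw [← htt]
    exact h3 k hk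

end Factorization

/-! ### The adjustment formula -/

section Adjustment

variable {D : Database.{u}}

theorem HypUpdate.mk_mem_nodes (U : HypUpdate D) {t : D.Tup (D.rel U.attr)} (ht : t ∈ U.units) :
    (⟨U.attr, t⟩ : D.GVar) ∈ U.nodes :=
  ⟨t, ht, rfl⟩

theorem HypUpdate.measurableSet_eq (U : HypUpdate D) (β : D.Tup (D.rel U.attr) → D.Dom U.attr) :
    MeasurableSet {a : D.World | ∀ t ∈ U.units, a ⟨U.attr, t⟩ = β t} := by
  simp only [Set.ofPred_forall]
  exact MeasurableSet.iInter fun t => MeasurableSet.iInter fun _ =>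
    (measurableSet_singleton (β t)).preimage (measurable_pi_apply (⟨U.attr, t⟩ : D.GVar))

/-- Consistency: if the treatments already have their new values, the update changes nothing. -/
theorem PRCM.solve_nodes_eq (M : PRCM D) (U : HypUpdate D) (ε : ∀ e, M.Noise e)
    (h : ∀ t ∈ U.units, M.solve ∅ D.inst ε ⟨U.attr, t⟩ = U.newVal t) :
    M.solve U.nodes U.newInst ε = M.solve ∅ D.inst ε := by
  funext v
  induction v using M.wf.induction with
  | _ v ih =>
    rw [M.solve_eq]
    split_ifs with hv
    · obtain ⟨t, ht, rfl⟩ := hv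
      rw [U.newInst_apply, h t ht]
    · rw [M.solve_eq ∅, if_neg (Set.notMem_empty v)]
      congr 1
      funext w
      exact ih w.1 w.2

theorem ENNReal.inv_mul_mul_cancel_left {a b c : ENNReal} (h0 : a * b ≠ 0) (h1 : a * b ≠ ⊤) :
    (a * b)⁻¹ * (a * c) = b⁻¹ * c := by
  have ha : a ≠ 0 := left_ne_zero_of_mul h0
  have hb : b ≠ 0 := right_ne_zero_of_mul h0
  have ha' : a ≠ ⊤ := fun h => h1 (by rw [h, ENNReal.top_mul hb])
  rw [ENNReal.mul_inv (Or.inl ha) (Or.inl ha'), mul_mul_mul_comm, ENNReal.inv_mul_cancel ha ha',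
    one_mul]

end Adjustment

theorem mainTheorem4 (D : Database.{u}) (M : PRCM D) (hM : M.Markovian)
    (𝒜 : Aggregation D) (hhom : 𝒜.Homogeneous M) (hsum : 𝒜.DistributionPreserving M)
    (U : HypUpdate D) (Y C : Set 𝒜.Node)
    (hC : BackdoorCriterion (𝒜.augGraph M) (Sum.inl '' U.nodes) Y C)
    (c : ∀ n : C, 𝒜.NodeDom n.1)
    (hpos : M.prObs {w | (∀ t ∈ U.units, w ⟨U.attr, t⟩ = U.newVal t) ∧
      ∀ n : C, 𝒜.value w n.1 = c n} ≠ 0)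
    (E : Set (∀ n : Y, 𝒜.NodeDom n.1)) (hE : MeasurableSet E) :
    -- Pr_{D, f(b)}(Y ∈ E | C = c) = Pr_D(Y ∈ E | B = f(b), C = c)
    ProbabilityTheory.cond (M.prUpdate U) {w | ∀ n : C, 𝒜.value w n.1 = c n}
        {w | (fun n : Y => 𝒜.value w n.1) ∈ E} =
      ProbabilityTheory.cond M.prObs
        {w | (∀ t ∈ U.units, w ⟨U.attr, t⟩ = U.newVal t) ∧ ∀ n : C, 𝒜.value w n.1 = c n}
        {w | (fun n : Y => 𝒜.value w n.1) ∈ E} ∧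
    -- Pr_{D, U}(Y ∈ E | B = b, C = c) = Pr_D(Y ∈ E | B = f(b), C = c),
    -- with Y read off after the update and B, C before it
    (M.prObs {w | (∀ t ∈ U.units, w ⟨U.attr, t⟩ = U.oldVal t) ∧
        ∀ n : C, 𝒜.value w n.1 = c n} ≠ 0 →
      ProbabilityTheory.cond (M.prPrePost U)
          {q | (∀ t ∈ U.units, q.1 ⟨U.attr, t⟩ = U.oldVal t) ∧
            ∀ n : C, 𝒜.value q.1 n.1 = c n}
          {q | (fun n : Y => 𝒜.value q.2 n.1) ∈ E} =
        ProbabilityTheory.cond M.prObs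
          {w | (∀ t ∈ U.units, w ⟨U.attr, t⟩ = U.newVal t) ∧ ∀ n : C, 𝒜.value w n.1 = c n}
          {w | (fun n : Y => 𝒜.value w n.1) ∈ E}) := by
  let pre : (∀ e, M.Noise e) → D.World := M.solve ∅ D.inst
  let post : (∀ e, M.Noise e) → D.World := M.solve U.nodes U.newInst
  have hpre : Measurable pre := M.measurable_solve _ _
  have hpost : Measurable post := M.measurable_solve _ _
  let Θ : (D.Tup (D.rel U.attr) → D.Dom U.attr) → Set D.World :=
    fun β => {w | ∀ t ∈ U.units, w ⟨U.attr, t⟩ = β t}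
  let Γ : Set D.World := {w | ∀ n : C, 𝒜.value w n.1 = c n}
  let E' : Set D.World := {w | (fun n : Y => 𝒜.value w n.1) ∈ E}
  have hΘ : ∀ β, MeasurableSet (Θ β) := U.measurableSet_eq
  have hΓ : MeasurableSet Γ := 𝒜.measurableSet_value_eq C c
  have hE' : MeasurableSet E' :=
    hE.preimage (measurable_pi_lambda _ fun n : Y => 𝒜.measurable_value n.1)
  have hΘT : ∀ β, ∀ a a' : D.World, (∀ v ∈ U.nodes, a v = a' v) → a ∈ Θ β → a' ∈ Θ β :=
    fun β a a' h ha t ht => (h _ (U.mk_mem_nodes ht)).symm.trans (ha t ht)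
  have hEY : ∀ a a' : D.World, (∀ n ∈ Y, 𝒜.value a n = 𝒜.value a' n) → a ∈ E' → a' ∈ E' := by
    intro a a' h ha
    have : (fun n : Y => 𝒜.value a' n.1) = fun n : Y => 𝒜.value a n.1 :=
      funext fun n => (h n.1 n.2).symm
    change (fun n : Y => 𝒜.value a' n.1) ∈ E
    rw [this]
    exact ha
  obtain ⟨r, -, hr⟩ := nonempty_of_measure_ne_zero hpos
  obtain ⟨κ, ρ, hfac⟩ := hC.exists_factorization hhom hM hsum U.newInst r
  have hΓr : ∀ a, (∀ n : C, 𝒜.value a n.1 = 𝒜.value r n.1) ↔ a ∈ Γ := fun a =>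
    forall_congr' fun n => by rw [hr n]
  simp only [hΓr] at hfac
  -- the conditional law of the post-update outcomes does not depend on the condition on the
  -- pre-update treatments
  have hcond : ∀ S : Set D.World, MeasurableSet S →
      (∀ a a' : D.World, (∀ v ∈ U.nodes, a v = a' v) → a ∈ S → a' ∈ S) →
      M.prNoise {ε | pre ε ∈ S ∧ pre ε ∈ Γ} ≠ 0 →
      (M.prNoise {ε | pre ε ∈ S ∧ pre ε ∈ Γ})⁻¹ *
        M.prNoise {ε | pre ε ∈ S ∧ pre ε ∈ Γ ∧ post ε ∈ E'} = (ρ Set.univ)⁻¹ * ρ E' := by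
    intro S hS hST h0
    have h1 := hfac S Set.univ hS .univ hST fun _ _ _ _ => trivial
    have h2 := hfac S E' hS hE' hST hEY
    simp only [Set.mem_univ, and_true] at h1
    have h1' : M.prNoise {ε | pre ε ∈ S ∧ pre ε ∈ Γ} = κ S * ρ Set.univ := h1
    have h2' : M.prNoise {ε | pre ε ∈ S ∧ pre ε ∈ Γ ∧ post ε ∈ E'} = κ S * ρ E' := h2
    have htop := measure_ne_top M.prNoise {ε | pre ε ∈ S ∧ pre ε ∈ Γ}
    rw [h1'] at h0 htop
    rw [h1', h2']
    exact ENNReal.inv_mul_mul_cancel_left h0 htop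
  have hobs : ∀ S : Set D.World, MeasurableSet S → M.prObs S = M.prNoise (pre ⁻¹' S) :=
    fun S hS => Measure.map_apply hpre hS
  have hB0 : M.prNoise {ε | pre ε ∈ Θ U.newVal ∧ pre ε ∈ Γ} ≠ 0 := by
    have := hobs _ ((hΘ U.newVal).inter hΓ)
    rw [show {ε | pre ε ∈ Θ U.newVal ∧ pre ε ∈ Γ} = pre ⁻¹' (Θ U.newVal ∩ Γ) from rfl, ← this]
    exact hpos
  have hrhs : ProbabilityTheory.cond M.prObs (Θ U.newVal ∩ Γ) E' = (ρ Set.univ)⁻¹ * ρ E' := by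
    have hs := (hΘ U.newVal).inter hΓ
    rw [cond_apply hs, hobs _ hs, hobs _ (hs.inter hE'),
      ← hcond (Θ U.newVal) (hΘ _) (hΘT _) hB0]
    congr 2
    ext ε
    constructor
    · rintro ⟨⟨h1, h2⟩, h3⟩
      refine ⟨h1, h2, ?_⟩
      rw [show post ε = pre ε from M.solve_nodes_eq U ε h1]
      exact h3
    · rintro ⟨h1, h2, h3⟩
      refine ⟨⟨h1, h2⟩, ?_⟩
      rw [show post ε = pre ε from M.solve_nodes_eq U ε h1] at h3
      exact h3
  refine ⟨?_, fun hb => ?_⟩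
  · have hdo : ∀ S : Set D.World, MeasurableSet S → M.prUpdate U S = M.prNoise (post ⁻¹' S) :=
      fun S hS => Measure.map_apply hpost hS
    -- the covariates are not affected by the update
    have hΓpost : ∀ ε, post ε ∈ Γ ↔ pre ε ∈ Γ := fun ε => forall_congr' fun n => by
      rw [M.value_solve_eq_of_mem hC U.newInst ε n.2]
    have h0 : M.prNoise {ε | pre ε ∈ (Set.univ : Set D.World) ∧ pre ε ∈ Γ} ≠ 0 := fun h =>
      hB0 (measure_mono_null (fun ε (hε : pre ε ∈ Θ U.newVal ∧ pre ε ∈ Γ) =>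
        show pre ε ∈ Set.univ ∧ pre ε ∈ Γ from ⟨trivial, hε.2⟩) h)
    refine Eq.trans ?_ hrhs.symm
    change ProbabilityTheory.cond (M.prUpdate U) Γ E' = _
    rw [cond_apply hΓ, hdo _ hΓ, hdo _ (hΓ.inter hE'),
      ← hcond Set.univ .univ (fun _ _ _ _ => trivial) h0]
    congr 2
    · congr 1
      ext ε
      exact ⟨fun h => ⟨trivial, (hΓpost ε).1 h⟩, fun h => (hΓpost ε).2 h.2⟩
    · ext ε
      exact ⟨fun h => ⟨trivial, (hΓpost ε).1 h.1, h.2⟩, fun h => ⟨(hΓpost ε).2 h.2.1, h.2.2⟩⟩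
  · have htwin : ∀ S : Set (D.World × D.World), MeasurableSet S →
        M.prPrePost U S = M.prNoise {ε | (pre ε, post ε) ∈ S} :=
      fun S hS => Measure.map_apply (hpre.prodMk hpost) hS
    have h0 : M.prNoise {ε | pre ε ∈ Θ U.oldVal ∧ pre ε ∈ Γ} ≠ 0 := by
      have := hobs _ ((hΘ U.oldVal).inter hΓ)
      rw [show {ε | pre ε ∈ Θ U.oldVal ∧ pre ε ∈ Γ} = pre ⁻¹' (Θ U.oldVal ∩ Γ) from rfl, ← this]
      exact hb
    have hs : MeasurableSet {q : D.World × D.World | q.1 ∈ Θ U.oldVal ∩ Γ} :=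
      ((hΘ U.oldVal).inter hΓ).preimage measurable_fst
    have he : MeasurableSet {q : D.World × D.World | q.2 ∈ E'} := hE'.preimage measurable_snd
    refine Eq.trans ?_ hrhs.symm
    change ProbabilityTheory.cond (M.prPrePost U) {q | q.1 ∈ Θ U.oldVal ∩ Γ} {q | q.2 ∈ E'} = _
    rw [cond_apply hs, htwin _ hs, htwin _ (hs.inter he), ← hcond _ (hΘ _) (hΘT _) h0]
    congr 2
    ext ε
    exact and_assoc
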